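/- Let $\Sigma$ be a set of labels (for instance an infinite one), each given by a binary name through a fixed injective map $\Sigma\to\{0,1\}^*$. Trees are finite, ordered, unranked, with vertices labelled in $\Sigma$. A DTD $d$ consists of a finite alphabet $\Sigma_d\subseteq\Sigma$, a start symbol $S_d\in\Sigma_d$, and a map $a\mapsto d(a)$ from $\Sigma_d$ to regular expressions over $\Sigma_d$. A tree matches $d$ if its root is labelled $S_d$ and, for every vertex $u$ with label $a$, we have $a\in\Sigma_d$ and the word formed by the labels of the children of $u$, from left to right, belongs to $L(d(a))$. An expression of $\mathrm{XP}(/,//)$ (no filters, wildcards or disjunction) is either a step $\mathit{axis}::a$, with axis self, child or descendant and $a\in\Sigma$, or a composition $p/q$ of two expressions. On a tree $t$ the step $\mathit{axis}::a$ defines the set of pairs $(u,v)$ of vertices such that $v$ has label $a$ and, according to the axis, $v=u$, $v$ is a child of $u$, or $v$ is a proper descendant of $u$; $p/q$ defines the composition of the relations defined by $p$ and $q$. Write $t\models p$ if $(\text{root},v)$ is in the relation defined by $p$ for some vertex $v$ of $t$, and $p\subseteq_d q$ if every tree $t$ that matches $d$ and satisfies $t\models p$ also satisfies $t\models q$. **Theorem.**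 The following problem is decidable in polynomial time: given a DTD $d$ and two expressions $p,q$ of $\mathrm{XP}(/,//)$, decide whether $p\subseteq_d q$. That is, there are a deterministic Turing machine (with several stacks or tapes) and a polynomial $f$ such that on every input $(d,p,q)$, written in the natural way as a word of length $n$ over a finite alphabet (labels by their binary names), the machine halts after at most $f(n)$ steps and outputs whether $p\subseteq_d q$. -/

import Mathlib

namespace XPathDTD

/-! ### Trees -/

/-- Finite ordered unranked trees whose vertices carry labels from `S`. -/
inductive XTree (S : Type) : Type where
  | node (label : S) (children : List (XTree S)) : XTree S

namespace XTree

variable {S : Type}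

/-- The label of the root. -/
def label : XTree S → S
  | node a _ => a

/-- The list of the immediate subtrees, from left to right. -/
def children : XTree S → List (XTree S)
  | node _ ts => ts

/-- Vertices are addressed by lists of child indices, as in a tree domain; the root is `[]` and
`u ++ [i]` is the `i`-th child of `u`, counted from `0`. `t.sub u` is the subtree of `t` rooted
at `u`, and `none` if `u` is not a vertex of `t`. -/
def sub : XTree S → List ℕ → Option (XTree S)
  | t, [] => some t
  | t, i :: u => (t.children[i]?).bind fun s => s.sub u

/-- `u` is a vertex of `t`. -/
def IsVertex (t : XTree S) (u : List ℕ) : Prop := ∃ s, t.sub u = some s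

/-- `u` is a vertex of `t` labelled `a`. -/
def HasLabel (t : XTree S) (u : List ℕ) (a : S) : Prop := ∃ s, t.sub u = some s ∧ s.label = a

end XTree

/-! ### DTDs -/

/-- All symbols that occur in the regular expression satisfy `A`. -/
def RegexOver {S : Type} (A : S → Prop) : RegularExpression S → Prop
  | .zero => True
  | .epsilon => True
  | .char a => A a
  | .plus r s => RegexOver A r ∧ RegexOver A s
  | .comp r s => RegexOver A r ∧ RegexOver A s
  | .star r => RegexOver A r

/-- A DTD: a finite alphabet, a start symbol in it, and a map from the alphabet to regular
expressions over the alphabet. The map is given by the finite list of its pairs (its graph), and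
the alphabet consists of the first components of these pairs. -/
structure DTD (S : Type) where
  rules : List (S × RegularExpression S)
  start : S
  functional : (rules.map Prod.fst).Nodup
  start_mem : start ∈ rules.map Prod.fst
  closed : ∀ x ∈ rules, RegexOver (fun a => a ∈ rules.map Prod.fst) x.2

/-- The tree `t` matches the DTD `d`: the root carries the start symbol, and at every vertex the
word formed by the labels of its children belongs to the language of the regular expression that
`d` assigns to the label of the vertex. -/
def DTD.Matches {S : Type} (d : DTD S) (t : XTree S) : Prop :=
  t.label = d.start ∧
    ∀ (u : List ℕ) (s : XTree S), t.sub u = some s →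
      ∃ r : RegularExpression S, (s.label, r) ∈ d.rules ∧ s.children.map XTree.label ∈ r.matches'

/-! ### XPath expressions with child and descendant axes, without filters, wildcards and
disjunction -/

/-- The axes of location steps. -/
inductive Axis : Type where
  | self
  | child
  | descendant

/-- `Axis.Rel x u v`: the axis `x` leads from the vertex `u` to the vertex `v`. -/
def Axis.Rel : Axis → List ℕ → List ℕ → Prop
  | .self, u, v => v = u
  | .child, u, v => ∃ i : ℕ, v = u ++ [i]
  | .descendant, u, v => ∃ w : List ℕ, w ≠ [] ∧ v = u ++ w

/-- Location paths: single steps `axis :: label`, and compositions `p / q`. -/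
inductive LPath (S : Type) : Type where
  | step (x : Axis) (a : S) : LPath S
  | seq (p q : LPath S) : LPath S

/-- The binary relation between the vertices of `t` that is defined by a location path. -/
def LPath.Sem {S : Type} (t : XTree S) : LPath S → List ℕ → List ℕ → Prop
  | .step x a => fun u v => t.IsVertex u ∧ t.HasLabel v a ∧ x.Rel u v
  | .seq p q => Relation.Comp (p.Sem t) (q.Sem t)

/-- `t` matches `p`: from the root, `p` selects some vertex. -/
def LPath.Holds {S : Type} (p : LPath S) (t : XTree S) : Prop := ∃ v : List ℕ, p.Sem t [] v

/-- `p` is contained in `q` relative to `d`: all trees that match `d` and `p` match `q`. -/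
def Contained {S : Type} (d : DTD S) (p q : LPath S) : Prop :=
  ∀ t : XTree S, d.Matches t → p.Holds t → q.Holds t

/-! ### Instances of the containment problem and their encoding as words -/

/-- An input of the containment problem. -/
structure Input (S : Type) where
  d : DTD S
  p : LPath S
  q : LPath S

/-- The finite alphabet in which inputs are written. -/
inductive Token : Type where
  | bit (b : Bool)
  | endLabel
  | zero
  | epsilon
  | alt
  | cat
  | star
  | self
  | child
  | descendant
  | slash
  | semicolon
  | separator

variable {S : Type}

/-- A label is written as its binary name, followed by an end marker. -/
def encLabel (e : S → List Bool) (a : S) : List Token := (e a).map Token.bit ++ [Token.endLabel]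

/-- Regular expressions are written in prefix notation. -/
def encRegex (e : S → List Bool) : RegularExpression S → List Token
  | .zero => [Token.zero]
  | .epsilon => [Token.epsilon]
  | .char a => encLabel e a
  | .plus r s => Token.alt :: (encRegex e r ++ encRegex e s)
  | .comp r s => Token.cat :: (encRegex e r ++ encRegex e s)
  | .star r => Token.star :: encRegex e r

/-- The start symbol, followed by the list of the rules. -/
def encDTD (e : S → List Bool) (d : DTD S) : List Token :=
  encLabel e d.start ++
    d.rules.flatMap fun x => encLabel e x.1 ++ encRegex e x.2 ++ [Token.semicolon]

/-- The token for an axis. -/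
def encAxis : Axis → Token
  | .self => Token.self
  | .child => Token.child
  | .descendant => Token.descendant

/-- Location paths are written in prefix notation. -/
def encPath (e : S → List Bool) : LPath S → List Token
  | .step x a => encAxis x :: encLabel e a
  | .seq p q => Token.slash :: (encPath e p ++ encPath e q)

/-- The word that encodes an input, where the label `a` has the binary name `e a`. -/
def encInput (e : S → List Bool) (x : Input S) : List Token :=
  encDTD e x.d ++ [Token.separator] ++ encPath e x.p ++ [Token.separator] ++ encPath e x.q

/-! ### Polynomial time -/

open Classical in
/-- The property `P` of the objects of type `α`, given as words through `enc`, is decidable in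
polynomial time: some deterministic Turing machine (with finitely many stacks in place of tapes),
started on the word `enc x`, halts after at most `f (enc x).length` steps, for a fixed
polynomial `f`, with the truth value of `P x` as its output. -/
def DecidableInPolyTime {α Γ : Type} (enc : α → List Γ) (P : α → Prop) : Prop :=
  Nonempty (Turing.TM2ComputableInPolyTime enc Computability.encodeBool fun x => decide (P x))

end XPathDTD

/-! Containment fails exactly when some tree valid for `d` has the start symbol at its root, matches
`p` and does not match `q`. The existence of such a tree is decided by a least fixed point over
polynomially many facts.

Since `q` is linear, whether it matches depends only on the words read on downward branches
(`stepsMatch_iff`). The label before each step of `q` is known: it is the start symbol or the label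
of the preceding step. So self steps can be resolved in advance, and `q` becomes a list of blocks: a
child step prolongs the current block, a descendant step opens a new one. The first block begins
with the symbol `none`, read only at the root, which anchors it there; a contradictory self step is
replaced by the block `[none, none]`, which never occurs. A branch matches `q` iff the blocks occur
in it one after the other (`occurs_blocksFrom`). Greedy leftmost search in the manner of Knuth,
Morris and Pratt recognizes this deterministically (`accepts_iff`), and its states are pairs of a
suffix of the block list and a prefix of the first remaining block, hence polynomially many. By
determinism, that no branch is accepted becomes a condition on the root and its children
(`avoids_iff`).

A fact `(a, s, p')` says that some valid tree with root label `a` avoids acceptance from `s` and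
matches the suffix `p'` of `p`. Since `p` is linear too, at most one child has to carry the
remaining steps; all others need only be valid and avoiding. So a rule applies if its regular
expression accepts a word over the admissible labels one letter of which can carry the rest, which
is decided by recursion on the expression (`foldr_regexStep`). The derived facts are true
(`facts_sound`). Conversely, the iteration is monotone and stabilizes within as many rounds as there
are candidates (`foldl_filter_fixed`), and every true fact among the candidates is derived by
induction on its tree (`facts_complete`).

For the running time, data are binary trees written in prefix code on the main stack of a program
with six binary stacks. The class `PT` is closed under composition, pairing, case distinction and
folds whose accumulator grows by a bounded amount per step (`PT.foldl_inv`). The procedure is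
composed of such operations, and a stack program is simulated step by step by a `TM2` machine
(`machineReach_of_reach`). -/

namespace StackProgram

/-! ### Stack programs -/

/-- The six stacks of a stack program. -/
inductive Reg : Type where
  | m | a | b | c | d | e
  deriving DecidableEq

instance : Fintype Reg where
  elems := {.m, .a, .b, .c, .d, .e}
  complete k := by cases k <;> decide

/-- The contents of the six stacks. -/
structure Mem where
  m : List Bool
  a : List Bool
  b : List Bool
  c : List Bool
  d : List Bool
  e : List Bool

/-- The content of a stack. -/
def Mem.get (s : Mem) : Reg → List Bool
  | .m => s.m
  | .a => s.a
  | .b => s.b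
  | .c => s.c
  | .d => s.d
  | .e => s.e

/-- Replace the content of a stack. -/
def Mem.set (s : Mem) (k : Reg) (l : List Bool) : Mem :=
  match k with
  | .m => { s with m := l }
  | .a => { s with a := l }
  | .b => { s with b := l }
  | .c => { s with c := l }
  | .d => { s with d := l }
  | .e => { s with e := l }

/-- The number of all symbols on the stacks. -/
def Mem.total (s : Mem) : ℕ :=
  s.m.length + s.a.length + s.b.length + s.c.length + s.d.length + s.e.length

/-- Instructions: push a bit, or pop a bit and branch. The target `none` means exit. -/
inductive Instr (Λ : Type) : Type where
  | push (k : Reg) (b : Bool) (n : Option Λ)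
  | pop (k : Reg) (n : Option Bool → Option Λ)

/-- Rename the targets of an instruction. -/
def Instr.map {Λ Λ' : Type} (φ : Option Λ → Option Λ') : Instr Λ → Instr Λ'
  | push k b n => push k b (φ n)
  | pop k n => pop k fun o => φ (n o)

/-- The next label and the next memory. -/
def Instr.next {Λ : Type} : Instr Λ → Mem → Option Λ × Mem
  | push k b n, s => (n, s.set k (b :: s.get k))
  | pop k n, s => (n (s.get k).head?, s.set k (s.get k).tail)

theorem Instr.next_map {Λ Λ' : Type} (φ : Option Λ → Option Λ') (i : Instr Λ) (s : Mem) :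
    (i.map φ).next s = (φ (i.next s).1, (i.next s).2) := by
  cases i <;> rfl

/-- `Reach code n l s l' s'`: from label `l` and memory `s`, `n` steps lead to `l'` and `s'`. -/
inductive Reach {Λ : Type} (code : Λ → Instr Λ) :
    ℕ → Option Λ → Mem → Option Λ → Mem → Prop
  | refl (l : Option Λ) (s : Mem) : Reach code 0 l s l s
  | step {n : ℕ} {l : Λ} {s : Mem} {l' : Option Λ} {s' : Mem}
      (h : Reach code n ((code l).next s).1 ((code l).next s).2 l' s') :
      Reach code (n + 1) (some l) s l' s'

theorem Reach.trans {Λ : Type} {code : Λ → Instr Λ} {n n' : ℕ} {l l' l'' : Option Λ}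
    {s s' s'' : Mem} (h : Reach code n l s l' s') (h' : Reach code n' l' s' l'' s'') :
    Reach code (n + n') l s l'' s'' := by
  induction h with
  | refl => simpa using h'
  | step _ ih =>
    rw [Nat.add_right_comm]
    exact .step (ih h')

/-- Embeds a component into a larger program. The map `φ` acts on targets including the exit, so the
exit of the component can become the entry of the next one. -/
theorem Reach.map {Λ Λ' : Type} {code : Λ → Instr Λ} {code' : Λ' → Instr Λ'}
    (φ : Option Λ → Option Λ') (g : Λ → Λ') (hφ : ∀ l, φ (some l) = some (g l))
    (hcode : ∀ l, code' (g l) = (code l).map φ) {n : ℕ} {l l' : Option Λ} {s s' : Mem}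
    (h : Reach code n l s l' s') : Reach code' n (φ l) s (φ l') s' := by
  induction h with
  | refl => exact .refl _ _
  | step _ ih =>
    rw [hφ]
    refine .step ?_
    rw [hcode, Instr.next_map]
    exact ih

theorem Instr.total_next {Λ : Type} (i : Instr Λ) (s : Mem) :
    (i.next s).2.total ≤ s.total + 1 := by
  cases i with
  | push k b n => cases k <;> simp [next, Mem.total, Mem.set, Mem.get] <;> omega
  | pop k n => cases k <;> simp [next, Mem.total, Mem.set, Mem.get] <;> omega

theorem Reach.total_le {Λ : Type} {code : Λ → Instr Λ} {n : ℕ} {l l' : Option Λ} {s s' : Mem}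
    (h : Reach code n l s l' s') : s'.total ≤ s.total + n := by
  induction h with
  | refl => simp
  | @step n l s l' s' _ ih =>
    have := (code l).total_next s
    omega

/-- A stack program with one entry and one exit. -/
structure Frag where
  Λ : Type
  fin : Fintype Λ
  entry : Λ
  code : Λ → Instr Λ

/-- Started in `s`, the program exits with memory `s'` after at most `n` steps. -/
def Frag.Runs (F : Frag) (s s' : Mem) (n : ℕ) : Prop :=
  ∃ k ≤ n, Reach F.code k (some F.entry) s none s'

theorem Frag.Runs.mono {F : Frag} {s s' : Mem} {n n' : ℕ} (h : F.Runs s s' n) (hn : n ≤ n') :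
    F.Runs s s' n' :=
  let ⟨k, hk, h⟩ := h
  ⟨k, hk.trans hn, h⟩

theorem Frag.Runs.total_le {F : Frag} {s s' : Mem} {n : ℕ} (h : F.Runs s s' n) :
    s'.total ≤ s.total + n := by
  obtain ⟨k, hk, h⟩ := h
  have := h.total_le
  omega

/-! ### Program constructors and their running times -/

namespace Frag

/-- Push one bit. -/
def push (k : Reg) (b : Bool) : Frag where
  Λ := Unit
  fin := inferInstance
  entry := ()
  code _ := .push k b none

/-- Pop one bit. -/
def pop (k : Reg) : Frag where
  Λ := Unit
  fin := inferInstance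
  entry := ()
  code _ := .pop k fun _ => none

/-- Sequential composition. -/
def seq (F G : Frag) : Frag where
  Λ := F.Λ ⊕ G.Λ
  fin := @instFintypeSum _ _ F.fin G.fin
  entry := .inl F.entry
  code
    | .inl l => (F.code l).map fun
      | none => some (.inr G.entry)
      | some l => some (.inl l)
    | .inr l => (G.code l).map (Option.map .inr)

/-- Pop a bit, run `F` if it is `true`, and `G` otherwise. -/
def branch (k : Reg) (F G : Frag) : Frag where
  Λ := Option (F.Λ ⊕ G.Λ)
  fin := @instFintypeOption _ (@instFintypeSum _ _ F.fin G.fin)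
  entry := none
  code
    | none => .pop k fun
      | some true => some (some (.inl F.entry))
      | _ => some (some (.inr G.entry))
    | some (.inl l) => (F.code l).map (Option.map fun l => some (.inl l))
    | some (.inr l) => (G.code l).map (Option.map fun l => some (.inr l))

/-- Pop a bit; if it is `true`, run `F` and start again. -/
def loop (k : Reg) (F : Frag) : Frag where
  Λ := Option F.Λ
  fin := @instFintypeOption _ F.fin
  entry := none
  code
    | none => .pop k fun
      | some true => some (some F.entry)
      | _ => none
    | some l => (F.code l).map some

theorem runs_push (k : Reg) (b : Bool) (s : Mem) :
    (push k b).Runs s (s.set k (b :: s.get k)) 1 :=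
  ⟨1, le_rfl, .step (.refl _ _)⟩

theorem runs_pop (k : Reg) (s : Mem) : (pop k).Runs s (s.set k (s.get k).tail) 1 :=
  ⟨1, le_rfl, .step (.refl _ _)⟩

theorem Runs.seq {F G : Frag} {s s' s'' : Mem} {n n' : ℕ} (h : F.Runs s s' n)
    (h' : G.Runs s' s'' n') : (F.seq G).Runs s s'' (n + n') := by
  obtain ⟨k, hk, h⟩ := h
  obtain ⟨k', hk', h'⟩ := h'
  refine ⟨k + k', by omega, Reach.trans (l' := some (.inr G.entry)) (s' := s') ?_ ?_⟩
  · exact h.map (code' := (F.seq G).code)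
      (fun | none => some (.inr G.entry) | some l => some (.inl l)) .inl
      (fun _ => rfl) (fun _ => rfl)
  · exact h'.map (code' := (F.seq G).code) (Option.map .inr) .inr (fun _ => rfl) (fun _ => rfl)

theorem Runs.branch_true {k : Reg} {F G : Frag} {s s' : Mem} {n : ℕ} {l : List Bool}
    (hs : s.get k = true :: l) (h : F.Runs (s.set k l) s' n) :
    (branch k F G).Runs s s' (n + 1) := by
  obtain ⟨j, hj, h⟩ := h
  refine ⟨j + 1, by omega, .step ?_⟩
  have := h.map (code' := (branch k F G).code) (Option.map fun l => some (.inl l))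
    (fun l => some (.inl l)) (fun _ => rfl) (fun _ => rfl)
  simpa [branch, Instr.next, hs] using this

theorem Runs.branch_false {k : Reg} {F G : Frag} {s s' : Mem} {n : ℕ} {l : List Bool}
    (hs : s.get k = false :: l) (h : G.Runs (s.set k l) s' n) :
    (branch k F G).Runs s s' (n + 1) := by
  obtain ⟨j, hj, h⟩ := h
  refine ⟨j + 1, by omega, .step ?_⟩
  have := h.map (code' := (branch k F G).code) (Option.map fun l => some (.inr l))
    (fun l => some (.inr l)) (fun _ => rfl) (fun _ => rfl)
  simpa [branch, Instr.next, hs] using this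

theorem Runs.loop_true {k : Reg} {F : Frag} {s s' s'' : Mem} {n n' : ℕ} {l : List Bool}
    (hs : s.get k = true :: l) (h : F.Runs (s.set k l) s' n) (h' : (loop k F).Runs s' s'' n') :
    (loop k F).Runs s s'' (n + n' + 1) := by
  obtain ⟨j, hj, h⟩ := h
  obtain ⟨j', hj', h'⟩ := h'
  refine ⟨j + j' + 1, by omega, .step ?_⟩
  have := h.map (code' := (loop k F).code) some some (fun _ => rfl) (fun _ => rfl)
  have := this.trans h'
  simpa [loop, Instr.next, hs] using this

theorem Runs.loop_false {k : Reg} {F : Frag} {s : Mem} {l : List Bool}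
    (hs : s.get k = false :: l) : (loop k F).Runs s (s.set k l) 1 := by
  refine ⟨1, by omega, .step ?_⟩
  simpa [loop, Instr.next, hs] using Reach.refl _ _

end Frag

/-! ### Data and their codes -/

/-- Binary trees, the data of the stack programs. -/
inductive Data : Type where
  | nil
  | cons (x y : Data)

/-- The number of nodes. -/
def Data.size : Data → ℕ
  | nil => 1
  | cons x y => x.size + y.size + 1

/-- The prefix code of a tree. -/
def Data.code : Data → List Bool
  | nil => [false]
  | cons x y => true :: (x.code ++ y.code)

theorem Data.length_code (x : Data) : x.code.length = x.size := by
  induction x with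
  | nil => rfl
  | cons x y hx hy => simp [code, size, hx, hy]

/-! ### Moving, copying and deleting codes on the main stack -/

namespace Frag

/-- The memory with five given stacks where `i` selects the roles of `a`, `b` and `d`, `e`. -/
def mem (i : Bool) (m u v c w z : List Bool) : Mem :=
  if i then ⟨m, u, v, c, w, z⟩ else ⟨m, w, z, c, u, v⟩

/-- The stack `a` or `d`. -/
def dst (i : Bool) : Reg := if i then .a else .d

/-- The stack `b` or `e`. -/
def cnt (i : Bool) : Reg := if i then .b else .e

/-- Move one bit from stack `m` to stack `dst i`, and count it. -/
def stashBody (i : Bool) : Frag :=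
  branch .m
    ((push (dst i) true).seq ((push (cnt i) true).seq ((push .c true).seq (push .c true))))
    ((push (dst i) false).seq (push (cnt i) true))

/-- Move one code from stack `m` to stack `dst i`, reversed, with its length on `cnt i`. -/
def stash (i : Bool) : Frag :=
  (push (cnt i) false).seq ((push .c false).seq ((push .c true).seq (loop .c (stashBody i))))

theorem runs_stashBody_true (i : Bool) (m u v c w z : List Bool) :
    (stashBody i).Runs (mem i (true :: m) u v c w z)
      (mem i m (true :: u) (true :: v) (true :: true :: c) w z) 5 := by
  cases i <;> exact Runs.branch_true rfl ((runs_push _ _ _).seq ((runs_push _ _ _).seq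
    ((runs_push _ _ _).seq (runs_push _ _ _))))

theorem runs_stashBody_false (i : Bool) (m u v c w z : List Bool) :
    (stashBody i).Runs (mem i (false :: m) u v c w z)
      (mem i m (false :: u) (true :: v) c w z) 3 := by
  cases i <;> exact Runs.branch_false rfl ((runs_push _ _ _).seq (runs_push _ _ _))

theorem replicate_append_cons {α : Type} (n : ℕ) (x : α) (l : List α) :
    List.replicate n x ++ x :: l = x :: (List.replicate n x ++ l) := by
  rw [← List.singleton_append, ← List.append_assoc, ← List.replicate_succ', List.replicate_succ,
    List.cons_append]

/-- The stack `c` counts in unary the codes still to be read: a `false` bit completes one, a `true`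
bit replaces one by two. The statement takes the rest of the run as a hypothesis, so that the
induction can chain the two subtrees of a node. Each node costs at most six steps. -/
theorem runs_stash_loop (i : Bool) (x : Data) (m u v c w z : List Bool) (s' : Mem) (n : ℕ)
    (h : (loop .c (stashBody i)).Runs
      (mem i m (x.code.reverse ++ u) (List.replicate x.size true ++ v) c w z) s' n) :
    (loop .c (stashBody i)).Runs (mem i (x.code ++ m) u v (true :: c) w z) s'
      (6 * x.size + n) := by
  induction x generalizing m u v c n with
  | nil =>
    have h0 := runs_stashBody_false i m u v c w z
    have hg : (mem i (false :: m) u v (true :: c) w z).get .c = true :: c := by cases i <;> rfl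
    have hs : (mem i (false :: m) u v (true :: c) w z).set .c c = mem i (false :: m) u v c w z := by
      cases i <;> rfl
    exact (Runs.loop_true hg (hs ▸ h0) h).mono (by simp [Data.size])
  | cons x y hx hy =>
    simp only [Data.code, List.cons_append, List.append_assoc]
    have h0 := runs_stashBody_true i (x.code ++ (y.code ++ m)) u v c w z
    have hg : (mem i (true :: (x.code ++ (y.code ++ m))) u v (true :: c) w z).get .c =
        true :: c := by cases i <;> rfl
    have hs : (mem i (true :: (x.code ++ (y.code ++ m))) u v (true :: c) w z).set .c c =
        mem i (true :: (x.code ++ (y.code ++ m))) u v c w z := by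
      cases i <;> rfl
    -- The run for `y` followed by the given rest is the continuation of the run for `x`.
    have h1 := hx (y.code ++ m) (true :: u) (true :: v) (true :: c) _ (hy _ _ _ _ _ (by
      convert h using 2
      · simp [Data.code]
      · simp only [Data.size, replicate_append_cons]
        rw [← List.append_assoc, ← List.replicate_add, ← List.cons_append, ← List.replicate_succ]
        congr 2
        omega))
    exact (Runs.loop_true hg (hs ▸ h0) h1).mono (by simp [Data.size]; omega)

theorem runs_stash (i : Bool) (x : Data) (m u v c w z : List Bool) :
    (stash i).Runs (mem i (x.code ++ m) u v c w z)
      (mem i m (x.code.reverse ++ u) (List.replicate x.size true ++ false :: v) c w z)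
      (6 * x.size + 4) := by
  have h := runs_stash_loop i x m u (false :: v) (false :: c) w z
    (mem i m (x.code.reverse ++ u) (List.replicate x.size true ++ false :: v) c w z) 1 (by
      cases i <;> exact Runs.loop_false rfl)
  cases i <;> exact ((runs_push _ _ _).seq ((runs_push _ _ _).seq ((runs_push _ _ _).seq h))).mono
    (by omega)

/-- Move the counted bits back from stack `dst i` to stack `m`. -/
def unstash (i : Bool) : Frag :=
  loop (cnt i) (branch (dst i) (push .m true) (push .m false))

theorem runs_unstash (i : Bool) (l m u v c w z : List Bool) :
    (unstash i).Runs (mem i m (l ++ u) (List.replicate l.length true ++ false :: v) c w z)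
      (mem i (l.reverse ++ m) u v c w z) (3 * l.length + 1) := by
  induction l generalizing m with
  | nil => cases i <;> exact Runs.loop_false rfl
  | cons t l ih =>
    have h := ih (t :: m)
    have h0 : (branch (dst i) (push .m true) (push .m false)).Runs
        (mem i m (t :: (l ++ u)) (List.replicate l.length true ++ false :: v) c w z)
        (mem i (t :: m) (l ++ u) (List.replicate l.length true ++ false :: v) c w z) 2 := by
      cases t
      · cases i <;> exact Runs.branch_false rfl (runs_push _ _ _)
      · cases i <;> exact Runs.branch_true rfl (runs_push _ _ _)
    simp only [List.length_cons, List.replicate_succ, List.cons_append, List.reverse_cons,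
      List.append_assoc, List.nil_append]
    refine Runs.mono (n := 2 + (3 * l.length + 1) + 1) ?_ (by omega)
    cases i <;> exact Runs.loop_true rfl h0 h

/-- Exchange the two topmost codes on stack `m`. -/
def swap : Frag :=
  (stash true).seq ((stash false).seq ((unstash true).seq (unstash false)))

/-- The first code is stashed on `a`, `b` and the second on `d`, `e`; restoring them in the same
order leaves the second on top. -/
theorem runs_swap (x y : Data) (m a b c d e : List Bool) :
    swap.Runs ⟨x.code ++ (y.code ++ m), a, b, c, d, e⟩ ⟨y.code ++ (x.code ++ m), a, b, c, d, e⟩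
      (9 * x.size + 9 * y.size + 10) := by
  have h1 := runs_stash true x (y.code ++ m) a b c d e
  have h2 := runs_stash false y m d e c (x.code.reverse ++ a)
    (List.replicate x.size true ++ false :: b)
  have h3 := runs_unstash true x.code.reverse m a b c (y.code.reverse ++ d)
    (List.replicate y.size true ++ false :: e)
  have h4 := runs_unstash false y.code.reverse (x.code ++ m) d e c a b
  simp only [List.length_reverse, Data.length_code, List.reverse_reverse] at h3 h4
  exact (h1.seq (h2.seq (h3.seq h4))).mono (by omega)

/-- Duplicate the counted bits of stack `a` on the stacks `m` and `d`, counting them on `e`. -/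
def fork : Frag :=
  loop .b (branch .a
    ((push .m true).seq ((push .d true).seq (push .e true)))
    ((push .m false).seq ((push .d false).seq (push .e true))))

theorem runs_fork (l m a b c d e : List Bool) :
    fork.Runs ⟨m, l ++ a, List.replicate l.length true ++ false :: b, c, d, e⟩
      ⟨l.reverse ++ m, a, b, c, l.reverse ++ d, List.replicate l.length true ++ e⟩
      (5 * l.length + 1) := by
  induction l generalizing m d e with
  | nil => exact Runs.loop_false rfl
  | cons t l ih =>
    have h := ih (t :: m) (t :: d) (true :: e)
    simp only [List.length_cons, List.replicate_succ, List.cons_append, List.reverse_cons,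
      List.append_assoc, List.nil_append]
    rw [replicate_append_cons] at h
    refine Runs.mono (n := 4 + (5 * l.length + 1) + 1) ?_ (by omega)
    refine Runs.loop_true rfl ?_ h
    cases t
    · exact Runs.branch_false rfl ((runs_push _ _ _).seq ((runs_push _ _ _).seq (runs_push _ _ _)))
    · exact Runs.branch_true rfl ((runs_push _ _ _).seq ((runs_push _ _ _).seq (runs_push _ _ _)))

/-- Move the counted bits of stack `d` to stack `a`, counting them on `b`. -/
def carry : Frag :=
  loop .e (branch .d ((push .a true).seq (push .b true)) ((push .a false).seq (push .b true)))

theorem runs_carry (l m a b c d e : List Bool) :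
    carry.Runs ⟨m, a, b, c, l ++ d, List.replicate l.length true ++ false :: e⟩
      ⟨m, l.reverse ++ a, List.replicate l.length true ++ b, c, d, e⟩ (4 * l.length + 1) := by
  induction l generalizing a b with
  | nil => exact Runs.loop_false rfl
  | cons t l ih =>
    have h := ih (t :: a) (true :: b)
    simp only [List.length_cons, List.replicate_succ, List.cons_append, List.reverse_cons,
      List.append_assoc, List.nil_append]
    rw [replicate_append_cons] at h
    refine Runs.mono (n := 3 + (4 * l.length + 1) + 1) ?_ (by omega)
    refine Runs.loop_true rfl ?_ h
    cases t
    · exact Runs.branch_false rfl ((runs_push _ _ _).seq (runs_push _ _ _))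
    · exact Runs.branch_true rfl ((runs_push _ _ _).seq (runs_push _ _ _))

/-- Duplicate the topmost code on stack `m`. -/
def dup : Frag :=
  (stash true).seq ((push .e false).seq (fork.seq
    ((push .b false).seq (carry.seq (unstash true)))))

/-- A stashed code is reversed, so `fork` writes it in its proper order on both `m` and `d`. `carry`
reverses the copy on `d` back to the stashed form on `a`, from which `unstash` restores it. -/
theorem runs_dup (x : Data) (m a b c d e : List Bool) :
    dup.Runs ⟨x.code ++ m, a, b, c, d, e⟩ ⟨x.code ++ (x.code ++ m), a, b, c, d, e⟩
      (18 * x.size + 9) := by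
  have h1 := runs_stash true x m a b c d e
  have h3 := runs_fork x.code.reverse m a b c d (false :: e)
  have h5 := runs_carry x.code (x.code ++ m) a (false :: b) c d e
  have h6 := runs_unstash true x.code.reverse (x.code ++ m) a b c d e
  simp only [List.length_reverse, Data.length_code, List.reverse_reverse] at h3 h5 h6
  exact (h1.seq ((runs_push _ _ _).seq (h3.seq ((runs_push _ _ _).seq (h5.seq h6))))).mono
    (by omega)

/-- Do nothing. -/
def skip : Frag := (push .c true).seq (pop .c)

theorem runs_skip (s : Mem) : skip.Runs s s 2 :=
  (runs_push _ _ _).seq (runs_pop _ _)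

/-- Remove the topmost code from stack `m`. -/
def drop : Frag :=
  (stash true).seq (loop .b (pop .a))

theorem runs_drop (x : Data) (m a b c d e : List Bool) :
    drop.Runs ⟨x.code ++ m, a, b, c, d, e⟩ ⟨m, a, b, c, d, e⟩ (8 * x.size + 5) := by
  have h1 := runs_stash true x m a b c d e
  have h2 : ∀ l : List Bool, (loop .b (pop .a)).Runs
      ⟨m, l ++ a, List.replicate l.length true ++ false :: b, c, d, e⟩ ⟨m, a, b, c, d, e⟩
      (2 * l.length + 1) := by
    intro l
    induction l with
    | nil => exact Runs.loop_false rfl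
    | cons t l ih =>
      refine Runs.mono (n := 1 + (2 * l.length + 1) + 1) ?_ (by simp; omega)
      exact Runs.loop_true rfl (runs_pop _ _) ih
  have h2 := h2 x.code.reverse
  simp only [List.length_reverse, Data.length_code] at h2
  exact (h1.seq h2).mono (by omega)

/-- Push a word on stack `m`. -/
def pushAll : List Bool → Frag
  | [] => skip
  | b :: l => (pushAll l).seq (push .m b)

theorem runs_pushAll (l m a b c d e : List Bool) :
    (pushAll l).Runs ⟨m, a, b, c, d, e⟩ ⟨l ++ m, a, b, c, d, e⟩ (l.length + 2) := by
  induction l with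
  | nil => exact runs_skip _
  | cons t l ih => exact (ih.seq (runs_push _ _ _)).mono (by simp)

end Frag

end StackProgram

namespace StackProgram

/-! ### Functions that are computed in polynomial time -/

/-- Types whose elements are represented by data. -/
class Enc (α : Type) where
  enc : α → Data

/-- The size of the representation. -/
def esize {α : Type} [Enc α] (x : α) : ℕ := (Enc.enc x).size

instance : Enc Bool where
  enc
    | false => .nil
    | true => .cons .nil .nil

instance {α β : Type} [Enc α] [Enc β] : Enc (α × β) where
  enc x := .cons (Enc.enc x.1) (Enc.enc x.2)

/-- The representation of lists. -/
def encList {α : Type} [Enc α] : List α → Data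
  | [] => .nil
  | a :: l => .cons (Enc.enc a) (encList l)

instance {α : Type} [Enc α] : Enc (List α) where
  enc := encList

instance {α : Type} [Enc α] : Enc (Option α) where
  enc o := Enc.enc o.toList

/-! ### Sizes of representations -/

section Size

variable {α β : Type} [Enc α] [Enc β]

theorem esize_prod (x : α × β) : esize x = esize x.1 + esize x.2 + 1 := rfl

theorem esize_nil : esize ([] : List α) = 1 := rfl

theorem esize_cons (a : α) (l : List α) : esize (a :: l) = esize a + esize l + 1 := rfl

theorem esize_pos (a : α) : 0 < esize a := by
  unfold esize
  cases Enc.enc a <;> simp [Data.size]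

theorem esize_bool_le (b : Bool) : esize b ≤ 3 := by
  cases b <;> decide

theorem esize_append (l l' : List α) : esize (l ++ l') + 1 = esize l + esize l' := by
  induction l with
  | nil => simp only [List.nil_append, esize_nil]; omega
  | cons a l ih => simp only [List.cons_append, esize_cons]; omega

theorem esize_le_of_mem {a : α} {l : List α} (h : a ∈ l) : esize a ≤ esize l := by
  induction h with
  | head => rw [esize_cons]; omega
  | tail _ _ ih => rw [esize_cons]; omega

theorem length_lt_esize (l : List α) : l.length < esize l := by
  induction l with
  | nil => exact Nat.one_pos
  | cons a l ih => rw [esize_cons, List.length_cons]; omega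

theorem esize_le_of_sublist {l l' : List α} (h : l.Sublist l') : esize l ≤ esize l' := by
  induction h with
  | slnil => rfl
  | cons a _ ih => rw [esize_cons]; omega
  | cons_cons a _ ih => rw [esize_cons, esize_cons]; omega

end Size

theorem eval_le_eval (p : Polynomial ℕ) {m n : ℕ} (h : m ≤ n) : p.eval m ≤ p.eval n := by
  rw [Polynomial.eval_eq_sum_range, Polynomial.eval_eq_sum_range]
  gcongr

open Polynomial in
/-- The program replaces the topmost code, of `x`, by the code of `f x`, in time `T`. -/
def Frag.Computes {α β : Type} [Enc α] [Enc β] (F : Frag) (f : α → β) (T : ℕ[X]) : Prop :=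
  ∀ (x : α) (m a b c d e : List Bool),
    F.Runs ⟨(Enc.enc x).code ++ m, a, b, c, d, e⟩ ⟨(Enc.enc (f x)).code ++ m, a, b, c, d, e⟩
      (T.eval (esize x))

open Polynomial in
/-- The function is computed by a stack program in polynomial time. -/
@[fun_prop]
def PT {α β : Type} [Enc α] [Enc β] (f : α → β) : Prop :=
  ∃ (F : Frag) (T : ℕ[X]), F.Computes f T

/-! ### Closure properties of `PT` -/

namespace PT

open Polynomial Frag

variable {α β γ δ : Type} [Enc α] [Enc β] [Enc γ] [Enc δ]

/-- A step adds at most one symbol to the stacks, so the size of the result is bounded by the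
running time plus the size of the input. Compositions stay polynomial for this reason. -/
theorem exists_size_le {f : α → β} (hf : PT f) :
    ∃ Q : ℕ[X], ∀ x, esize (f x) ≤ Q.eval (esize x) := by
  obtain ⟨F, T, hF⟩ := hf
  refine ⟨T + X, fun x => ?_⟩
  have := (hF x [] [] [] [] [] []).total_le
  simpa [Mem.total, Data.length_code, esize, add_comm] using this

/-- Mere changes of type cost nothing: a nonempty list has the same representation as the pair of
its head and tail. -/
theorem of_enc_eq {f : α → β} (h : ∀ x, Enc.enc (f x) = Enc.enc x) : PT f :=
  ⟨skip, C 2, fun x m a b c d e => by rw [h]; simpa using runs_skip _⟩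

theorem congr_enc {f : α → β} {g : α → γ} (hf : PT f) (h : ∀ x, Enc.enc (g x) = Enc.enc (f x)) :
    PT g := by
  obtain ⟨F, T, hF⟩ := hf
  exact ⟨F, T, fun x m a b c d e => by rw [h]; exact hF x m a b c d e⟩

theorem congr {f g : α → β} (hf : PT f) (h : ∀ x, g x = f x) : PT g :=
  hf.congr_enc fun x => by rw [h]

@[fun_prop]
theorem id : PT (fun x : α => x) := of_enc_eq fun _ => rfl

@[fun_prop]
theorem comp {g : β → γ} {f : α → β} (hg : PT g) (hf : PT f) : PT fun x => g (f x) := by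
  obtain ⟨Q, hQ⟩ := hf.exists_size_le
  obtain ⟨F, T, hF⟩ := hf
  obtain ⟨G, T', hG⟩ := hg
  refine ⟨F.seq G, T + T'.comp Q, fun x m a b c d e => ?_⟩
  refine ((hF x m a b c d e).seq (hG (f x) m a b c d e)).mono ?_
  rw [eval_add, eval_comp]
  gcongr
  exact eval_le_eval _ (hQ x)

@[fun_prop]
theorem const (y : β) : PT (fun _ : α => y) := by
  refine ⟨drop.seq (pushAll (Enc.enc y).code), C 8 * X + C (esize y + 7),
    fun x m a b c d e => ?_⟩
  refine ((runs_drop _ m a b c d e).seq (runs_pushAll _ m a b c d e)).mono ?_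
  simp [Data.length_code, esize]
  omega

@[fun_prop]
theorem prodMk {f : α → β} {g : α → γ} (hf : PT f) (hg : PT g) : PT fun x => (f x, g x) := by
  obtain ⟨Q, hQ⟩ := hf.exists_size_le
  obtain ⟨Q', hQ'⟩ := hg.exists_size_le
  obtain ⟨F, T, hF⟩ := hf
  obtain ⟨G, T', hG⟩ := hg
  -- From the top, the main stack becomes `x, x`, then `f x, x`, then `x, f x`, then `g x, f x`,
  -- then `f x, g x`; the last bit makes these two codes a pair.
  refine ⟨dup.seq (F.seq (swap.seq (G.seq (swap.seq (push .m true))))),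
    T + T' + C 27 * X + C 18 * Q + C 9 * Q' + C 30, fun x m a b c d e => ?_⟩
  have h1 := runs_dup (Enc.enc x) m a b c d e
  have h2 := hF x ((Enc.enc x).code ++ m) a b c d e
  have h3 := runs_swap (Enc.enc (f x)) (Enc.enc x) m a b c d e
  have h4 := hG x ((Enc.enc (f x)).code ++ m) a b c d e
  have h5 := runs_swap (Enc.enc (g x)) (Enc.enc (f x)) m a b c d e
  have h := (h1.seq (h2.seq (h3.seq (h4.seq (h5.seq (runs_push .m true _)))))).mono
    (n' := (T + T' + C 27 * X + C 18 * Q + C 9 * Q' + C 30).eval (esize x)) (by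
      have := hQ x
      have := hQ' x
      simp only [eval_add, eval_mul, eval_C, eval_X]
      simp only [esize] at *
      omega)
  simpa [Enc.enc, Data.code, Mem.set, Mem.get] using h

@[fun_prop]
theorem fst' : PT (fun x : α × β => x.1) := by
  refine ⟨(pop .m).seq (swap.seq drop), C 17 * X + C 16, fun x m a b c d e => ?_⟩
  have h1 := runs_pop .m ⟨true :: ((Enc.enc x.1).code ++ ((Enc.enc x.2).code ++ m)), a, b, c, d, e⟩
  have h2 := runs_swap (Enc.enc x.1) (Enc.enc x.2) m a b c d e
  have h3 := runs_drop (Enc.enc x.2) ((Enc.enc x.1).code ++ m) a b c d e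
  have h := (h1.seq (h2.seq h3)).mono (n' := (C 17 * X + C 16 : ℕ[X]).eval (esize x)) (by
    simp only [eval_add, eval_mul, eval_C, eval_X, esize_prod]
    simp only [esize]
    omega)
  simpa [Enc.enc, Data.code] using h

@[fun_prop]
theorem snd' : PT (fun x : α × β => x.2) := by
  refine ⟨(pop .m).seq drop, C 8 * X + C 6, fun x m a b c d e => ?_⟩
  have h1 := runs_pop .m ⟨true :: ((Enc.enc x.1).code ++ ((Enc.enc x.2).code ++ m)), a, b, c, d, e⟩
  have h3 := runs_drop (Enc.enc x.1) ((Enc.enc x.2).code ++ m) a b c d e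
  have h := (h1.seq h3).mono (n' := (C 8 * X + C 6 : ℕ[X]).eval (esize x)) (by
    simp only [eval_add, eval_mul, eval_C, eval_X, esize_prod]
    simp only [esize]
    omega)
  simpa [Enc.enc, Data.code] using h

@[fun_prop]
theorem fst {f : γ → α × β} (hf : PT f) : PT fun x => (f x).1 := fst'.comp hf

@[fun_prop]
theorem snd {f : γ → α × β} (hf : PT f) : PT fun x => (f x).2 := snd'.comp hf

@[fun_prop]
theorem cons {f : γ → α} {g : γ → List α} (hf : PT f) (hg : PT g) : PT fun x => f x :: g x :=
  (of_enc_eq (f := fun x : α × List α => x.1 :: x.2) fun _ => rfl).comp (hf.prodMk hg)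

theorem ite {p : γ → Bool} {f g : γ → α} (hp : PT p) (hf : PT f) (hg : PT g) :
    PT fun x => if p x then f x else g x := by
  suffices h : PT fun x : Bool × γ => if x.1 then f x.2 else g x.2 from
    h.comp (hp.prodMk id)
  obtain ⟨F, T, hF⟩ := hf
  obtain ⟨G, T', hG⟩ := hg
  -- The first pop removes the bit of the pair. The code of `true` is `true, false, false`, so two
  -- bits remain to be removed after the branch.
  refine ⟨(pop .m).seq (branch .m ((pop .m).seq ((pop .m).seq F)) G), T + T' + C 4,
    fun x m a b c d e => ?_⟩
  obtain ⟨t, x⟩ := x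
  have hx : esize x ≤ esize (t, x) := by simp only [esize_prod]; omega
  cases t
  · refine ((runs_pop _ _).seq (Runs.branch_false rfl (hG x m a b c d e))).mono ?_
    have := eval_le_eval T' hx
    simp only [eval_add, eval_C]
    omega
  · refine ((runs_pop _ _).seq (Runs.branch_true rfl ((runs_pop _ _).seq ((runs_pop _ _).seq
      (hF x m a b c d e))))).mono ?_
    have := eval_le_eval T hx
    simp only [eval_add, eval_C]
    omega

theorem listCase {l : γ → List α} {f : γ → β} {g : γ → α → List α → β} (hl : PT l) (hf : PT f)
    (hg : PT fun x : (α × List α) × γ => g x.2 x.1.1 x.1.2) :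
    PT fun x => match l x with
      | [] => f x
      | a :: t => g x a t := by
  suffices h : PT fun x : List α × γ => (match x.1 with
      | [] => f x.2
      | a :: t => g x.2 a t : β) from
    h.comp (hl.prodMk id)
  obtain ⟨F, T, hF⟩ := hf
  obtain ⟨G, T', hG⟩ := hg
  -- The pairs `(y :: t, x)` and `((y, t), x)` have the same code, so in the nonempty case the two
  -- bits consumed by the test are simply put back.
  refine ⟨(pop .m).seq (branch .m ((push .m true).seq ((push .m true).seq G)) F), T + T' + C 4,
    fun x m a b c d e => ?_⟩
  obtain ⟨l, x⟩ := x
  have hx : esize x ≤ esize (l, x) := by simp only [esize_prod]; omega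
  cases l with
  | nil =>
    refine ((runs_pop _ _).seq (Runs.branch_false rfl (hF x m a b c d e))).mono ?_
    have := eval_le_eval T hx
    simp only [eval_add, eval_C]
    omega
  | cons y t =>
    have h0 : G.Runs ⟨true :: true :: ((Enc.enc y).code ++ ((Enc.enc t).code ++
        ((Enc.enc x).code ++ m))), a, b, c, d, e⟩ ⟨(Enc.enc (g x y t)).code ++ m, a, b, c, d, e⟩
        (T'.eval (esize (y :: t, x))) := by
      have hs : esize (y :: t, x) = esize ((y, t), x) := rfl
      rw [hs]
      simpa [Enc.enc, Data.code] using hG ((y, t), x) m a b c d e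
    have h : ((pop .m).seq (branch .m ((push .m true).seq ((push .m true).seq G)) F)).Runs
        ⟨true :: true :: ((Enc.enc y).code ++ ((Enc.enc t).code ++
          ((Enc.enc x).code ++ m))), a, b, c, d, e⟩
        ⟨(Enc.enc (g x y t)).code ++ m, a, b, c, d, e⟩ ((T + T' + C 4).eval (esize (y :: t, x))) :=
      ((runs_pop _ _).seq (Runs.branch_true rfl ((runs_push _ _ _).seq
        ((runs_push _ _ _).seq h0)))).mono (by simp only [eval_add, eval_C]; omega)
    simpa [Enc.enc, Data.code, encList] using h

/-- The leading bit of the list code controls the loop. On `true`, two bits are pushed so that `G`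
sees the pair of list and accumulator, and the bit of the resulting pair is removed afterwards. On
`false`, the code of the empty list has just been consumed and the accumulator is left. A common
bound `B` on all intermediate pairs bounds every round. -/
theorem runs_foldl {σ : Type} [Enc σ] {st : σ → α → σ} {G : Frag} {T : ℕ[X]}
    {g : List α × σ → List α × σ} (hG : G.Computes g T)
    (hg : ∀ a l s, g (a :: l, s) = (l, st s a)) (B : ℕ) (l : List α) (s : σ)
    (hB : ∀ l₁ l₂, l = l₁ ++ l₂ → esize (l₂, l₁.foldl st s) ≤ B) (m a b c d e : List Bool) :
    (loop .m ((push .m true).seq ((push .m true).seq (G.seq (pop .m))))).Runs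
      ⟨(Enc.enc l).code ++ ((Enc.enc s).code ++ m), a, b, c, d, e⟩
      ⟨(Enc.enc (l.foldl st s)).code ++ m, a, b, c, d, e⟩
      (l.length * (T.eval B + 4) + 1) := by
  induction l generalizing s with
  | nil => exact (Runs.loop_false rfl).mono (by simp)
  | cons y l ih =>
    have h1 := hG (y :: l, s) m a b c d e
    rw [hg] at h1
    have h2 := ih (st s y) fun l₁ l₂ h => hB (y :: l₁) l₂ (by rw [h]; rfl)
    have h3 : (Enc.enc (y :: l)).code ++ ((Enc.enc s).code ++ m) =
        true :: ((Enc.enc y).code ++ ((Enc.enc l).code ++ ((Enc.enc s).code ++ m))) := by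
      simp [Enc.enc, encList, Data.code]
    have h4 : (Enc.enc (y :: l, s)).code ++ m =
        true :: true :: ((Enc.enc y).code ++ ((Enc.enc l).code ++ ((Enc.enc s).code ++ m))) := by
      simp [Enc.enc, encList, Data.code]
    have h5 : (Enc.enc (l, st s y)).code ++ m =
        true :: ((Enc.enc l).code ++ ((Enc.enc (st s y)).code ++ m)) := by
      simp [Enc.enc, Data.code]
    rw [h4, h5] at h1
    rw [h3]
    refine Runs.mono (Runs.loop_true rfl ((runs_push _ _ _).seq ((runs_push _ _ _).seq
      (h1.seq (runs_pop _ _)))) h2) ?_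
    have := eval_le_eval T (hB [] (y :: l) rfl)
    simp only [List.foldl_nil] at this
    rw [List.length_cons, Nat.succ_mul]
    omega

/-- Iterating an arbitrary polynomial time step could square the size in every round. Growth by an
amount that depends only on the input keeps the accumulator polynomial, since the number of rounds
is polynomial. The invariant serves steps whose growth is so bounded only on reachable accumulators.
-/
theorem foldl_inv {l : γ → List α} {i : γ → β} {st : γ → β → α → β} (hl : PT l) (hi : PT i)
    (hst : PT fun x : (γ × β) × α => st x.1.1 x.1.2 x.2) (Inv : γ → β → Prop) (Q : ℕ[X])
    (h0 : ∀ x, Inv x (i x))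
    (h : ∀ x b, ∀ a ∈ l x, Inv x b →
      Inv x (st x b a) ∧ esize (st x b a) ≤ esize b + Q.eval (esize x)) :
    PT fun x => (l x).foldl (st x) (i x) := by
  -- The input `x` travels along with the accumulator because the step function uses it.
  have hstart : PT fun x => (l x, i x, x) := by fun_prop
  have hstep : PT fun y : List α × β × γ => (match y.1 with
      | [] => y
      | a :: t => (t, st y.2.2 y.2.1 a, y.2.2) : List α × β × γ) := by
    refine listCase (g := fun (y : List α × β × γ) a t => (t, st y.2.2 y.2.1 a, y.2.2)) (by fun_prop) (by fun_prop) ?_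
    refine (snd (fst id)).prodMk (.prodMk ?_ (by fun_prop))
    exact hst.comp (f := fun y : (α × List α) × List α × β × γ => ((y.2.2.2, y.2.2.1), y.1.1))
      (by fun_prop)
  obtain ⟨Ql, hQl⟩ := hl.exists_size_le
  obtain ⟨Qi, hQi⟩ := hi.exists_size_le
  obtain ⟨F, T, hF⟩ := hstart
  obtain ⟨G, T', hG⟩ := hstep
  obtain ⟨H, T'', hH⟩ := fst' (α := β) (β := γ)
  have hsize : ∀ x l₁ l₂, l x = l₁ ++ l₂ →
      Inv x (l₁.foldl (st x) (i x)) ∧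
      esize (l₁.foldl (st x) (i x)) ≤ Qi.eval (esize x) + l₁.length * Q.eval (esize x) := by
    intro x l₁
    induction l₁ using List.reverseRecOn with
    | nil => intro l₂ _; exact ⟨h0 x, by simpa using hQi x⟩
    | append_singleton l₁ a ih =>
      intro l₂ hl₂
      obtain ⟨h1, h2⟩ := ih (a :: l₂) (by rw [hl₂]; simp)
      obtain ⟨h3, h4⟩ := h x _ a (by rw [hl₂]; simp) h1
      rw [List.foldl_append]
      refine ⟨h3, h4.trans ?_⟩
      rw [List.length_append, add_mul]
      simp only [List.length_singleton, one_mul]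
      omega
  -- This adds up the remaining list, the accumulator after at most `Ql` rounds, the input, and the
  -- two nodes of the nested pair.
  set B : ℕ[X] := Ql + Qi + Ql * Q + X + C 2 with hBdef
  refine ⟨F.seq ((pop .m).seq ((loop .m ((push .m true).seq ((push .m true).seq
    (G.seq (pop .m))))).seq H)), T + Ql * (T'.comp B + C 4) + T''.comp B + C 2,
    fun x m a b c d e => ?_⟩
  have hlen : (l x).length ≤ Ql.eval (esize x) := (length_lt_esize _).le.trans (hQl x)
  have hfold : ∀ l₁ l₂, l x = l₁ ++ l₂ →
      (l₁.foldl (fun (s : β × γ) a => (st s.2 s.1 a, s.2)) (i x, x)) =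
        (l₁.foldl (st x) (i x), x) := by
    intro l₁ l₂ _
    generalize i x = j
    clear * -
    induction l₁ generalizing j with
    | nil => rfl
    | cons a l₁ ih => exact ih _
  have hB : ∀ l₁ l₂, l x = l₁ ++ l₂ →
      esize (l₂, l₁.foldl (fun (s : β × γ) a => (st s.2 s.1 a, s.2)) (i x, x)) ≤
        B.eval (esize x) := by
    intro l₁ l₂ h12
    rw [hfold l₁ l₂ h12]
    have h1 := (hsize x l₁ l₂ h12).2
    have h2 : l₁.length ≤ Ql.eval (esize x) := by
      rw [h12, List.length_append] at hlen
      omega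
    have h3 : esize l₂ ≤ esize (l x) := esize_le_of_sublist (by rw [h12]; simp)
    have h4 := Nat.mul_le_mul_right (Q.eval (esize x)) h2
    have h5 := hQl x
    simp only [hBdef, esize_prod, eval_add, eval_mul, eval_X, eval_C]
    omega
  have h1 := hF x m a b c d e
  have h3 := runs_foldl hG (st := fun (s : β × γ) a => (st s.2 s.1 a, s.2)) (fun _ _ _ => rfl)
    (B.eval (esize x)) (l x) (i x, x) hB m a b c d e
  have hend := hB (l x) [] (by simp)
  rw [hfold (l x) [] (by simp)] at h3 hend
  have h4 := hH ((l x).foldl (st x) (i x), x) m a b c d e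
  have h5 : (Enc.enc (l x, i x, x)).code ++ m =
      true :: ((Enc.enc (l x)).code ++ ((Enc.enc (i x, x)).code ++ m)) := by
    simp [Enc.enc, Data.code]
  rw [h5] at h1
  refine (h1.seq ((runs_pop _ _).seq (h3.seq h4))).mono ?_
  have h6 := eval_le_eval T'' (n := B.eval (esize x))
    (m := esize ((l x).foldl (st x) (i x), x)) (by rw [esize_prod] at hend; simp only at hend; omega)
  have h7 := Nat.mul_le_mul_right (T'.eval (B.eval (esize x)) + 4) hlen
  simp only [eval_add, eval_mul, eval_comp, eval_C]
  omega

theorem foldl {l : γ → List α} {i : γ → β} {st : γ → β → α → β} (hl : PT l) (hi : PT i)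
    (hst : PT fun x : (γ × β) × α => st x.1.1 x.1.2 x.2) (Q : ℕ[X])
    (h : ∀ x b, ∀ a ∈ l x, esize (st x b a) ≤ esize b + Q.eval (esize x)) :
    PT fun x => (l x).foldl (st x) (i x) :=
  foldl_inv hl hi hst (fun _ _ => True) Q (fun _ => trivial) fun x b a ha _ => ⟨trivial, h x b a ha⟩

end PT

end StackProgram

namespace StackProgram

/-! ### From stack programs to Turing machines -/

open Turing Polynomial

/-- The stack alphabets of the machine: input stack, output stack, and the stacks of the
program. -/
@[reducible]
def Alphabet (Γ : Type) : Option (Option Reg) → Type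
  | none => Γ
  | some none => Bool
  | some (some _) => Bool

/-- The stacks of the machine. -/
def stackFun {Γ : Type} (i : List Γ) (o : List Bool) (s : Mem) :
    ∀ k : Option (Option Reg), List (Alphabet Γ k)
  | none => i
  | some none => o
  | some (some k) => s.get k

theorem update_stackFun_reg {Γ : Type} (i : List Γ) (o : List Bool) (s : Mem) (k : Reg)
    (l : List Bool) :
    Function.update (stackFun i o s) (some (some k)) l = stackFun i o (s.set k l) := by
  funext j
  rcases j with _ | _ | j
  · rfl
  · rfl
  · by_cases h : j = k
    · subst h
      refine (Function.update_self _ _ _).trans ?_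
      cases j <;> rfl
    · refine (Function.update_of_ne (by simpa using h) _ _).trans ?_
      cases j <;> cases k <;> first | rfl | exact absurd rfl h

theorem update_stackFun_inp {Γ : Type} (i i' : List Γ) (o : List Bool) (s : Mem) :
    Function.update (stackFun i o s) none i' = stackFun i' o s := by
  funext j
  rcases j with _ | _ | j <;> rfl

theorem update_stackFun_out {Γ : Type} (i : List Γ) (o o' : List Bool) (s : Mem) :
    Function.update (stackFun i o s) (some none) o' = stackFun i o' s := by
  funext j
  rcases j with _ | _ | j <;> rfl

/-- The labels of the machine: initialization and reading (`Bool`), conversion of an input symbol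
(`Γ`), and the labels and the exit of the program. -/
abbrev MachineLabel (Γ : Type) (F : Frag) : Type := Bool ⊕ Γ ⊕ Option F.Λ

/-- Statements of the machine. -/
abbrev MachineStmt (Γ : Type) (F : Frag) : Type :=
  TM2.Stmt (Alphabet Γ) (MachineLabel Γ F) (Option (Γ ⊕ Bool))

/-- Push a word on the main stack. -/
def pushWord {Γ : Type} {F : Frag} : List Bool → MachineStmt Γ F → MachineStmt Γ F
  | [], q => q
  | b :: l, q => pushWord l (.push (some (some .m)) (fun _ => b) q)

/-- The statement for an instruction of the program. -/
def instrStmt {Γ : Type} {F : Frag} : Instr F.Λ → MachineStmt Γ F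
  | .push k b n => .push (some (some k)) (fun _ => b) (.goto fun _ => .inr (.inr n))
  | .pop k n => .pop (some (some k)) (fun _ o => o.map .inr)
      (.goto fun v => .inr (.inr (n (v.bind Sum.getRight?))))

/-- The program of the machine: represent the input on the main stack, run `F`, and convert the
result. -/
def machineCode {Γ : Type} [Enc Γ] (F : Frag) : MachineLabel Γ F → MachineStmt Γ F
  | .inl true => .push (some (some .m)) (fun _ => false) (.goto fun _ => .inl false)
  | .inl false => .pop none (fun _ o => o.map .inl) (.goto fun v =>
      match v.bind Sum.getLeft? with
      | none => .inr (.inr (some F.entry))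
      | some t => .inr (.inl t))
  | .inr (.inl t) => pushWord (true :: (Enc.enc t).code) (.goto fun _ => .inl false)
  | .inr (.inr (some l)) => instrStmt (F.code l)
  | .inr (.inr none) => .pop (some (some .m)) (fun _ o => o.map .inr)
      (.branch (fun v => (v.bind Sum.getRight?).getD false)
        (.pop (some (some .m)) (fun v _ => v) (.pop (some (some .m)) (fun _ _ => none)
          (.push (some none) (fun _ => true) .halt)))
        (.load (fun _ => none) (.push (some none) (fun _ => false) .halt)))

/-- The Turing machine for a stack program. -/
def machine (Γ : Type) [Fintype Γ] [Enc Γ] (F : Frag) : FinTM2 :=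
  letI := F.fin
  { K := Option (Option Reg)
    k₀ := none
    k₁ := some none
    Γ := Alphabet Γ
    Λ := MachineLabel Γ F
    main := .inl true
    σ := Option (Γ ⊕ Bool)
    initialState := none
    Γk₀Fin := inferInstanceAs (Fintype Γ)
    m := machineCode F }

variable {Γ : Type} {F : Frag}

/-! ### Single statements of the machine -/

section StepAux

variable (q : MachineStmt Γ F) (v : Option (Γ ⊕ Bool)) (i : List Γ) (o : List Bool) (s : Mem)

theorem stepAux_push_reg (k : Reg) (f : Option (Γ ⊕ Bool) → Bool) :
    TM2.stepAux (.push (some (some k)) f q) v (stackFun i o s) =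
      TM2.stepAux q v (stackFun i o (s.set k (f v :: s.get k))) :=
  congrArg (TM2.stepAux q v) (update_stackFun_reg _ _ _ _ _)

theorem stepAux_pop_reg (k : Reg) (f : Option (Γ ⊕ Bool) → Option Bool → Option (Γ ⊕ Bool)) :
    TM2.stepAux (.pop (some (some k)) f q) v (stackFun i o s) =
      TM2.stepAux q (f v (s.get k).head?) (stackFun i o (s.set k (s.get k).tail)) :=
  congrArg (TM2.stepAux q _) (update_stackFun_reg _ _ _ _ _)

theorem stepAux_pop_inp (f : Option (Γ ⊕ Bool) → Option Γ → Option (Γ ⊕ Bool)) :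
    TM2.stepAux (.pop none f q) v (stackFun i o s) =
      TM2.stepAux q (f v i.head?) (stackFun i.tail o s) :=
  congrArg (TM2.stepAux q _) (update_stackFun_inp _ _ _ _)

theorem stepAux_push_out (f : Option (Γ ⊕ Bool) → Bool) :
    TM2.stepAux (.push (some none) f q) v (stackFun i o s) =
      TM2.stepAux q v (stackFun i (f v :: o) s) :=
  congrArg (TM2.stepAux q v) (update_stackFun_out _ _ _ _)

theorem stepAux_pushWord (l : List Bool) :
    TM2.stepAux (pushWord l q) v (stackFun i o s) =
      TM2.stepAux q v (stackFun i o (s.set .m (l ++ s.get .m))) := by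
  induction l generalizing q with
  | nil => rfl
  | cons b l ih =>
    rw [pushWord, ih, stepAux_push_reg]
    rfl

end StepAux

variable [Enc Γ]

/-- Configurations of the machine. -/
abbrev MachineCfg (Γ : Type) (F : Frag) : Type :=
  TM2.Cfg (Alphabet Γ) (MachineLabel Γ F) (Option (Γ ⊕ Bool))

/-- `MachineReach n x y`: the machine goes from `x` to `y` in `n` steps. -/
def MachineReach (n : ℕ) (x y : MachineCfg Γ F) : Prop :=
  (flip bind (TM2.step (machineCode F)))^[n] (some x) = some y

theorem MachineReach.trans {n n' : ℕ} {x y z : MachineCfg Γ F} (h : MachineReach n x y)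
    (h' : MachineReach n' y z) : MachineReach (n' + n) x z := by
  unfold MachineReach at *
  rw [Function.iterate_add_apply, h, h']

theorem MachineReach.one {x y : MachineCfg Γ F} (h : TM2.step (machineCode F) x = some y) :
    MachineReach 1 x y := h

/-- Each instruction is one machine step. The internal state only carries the popped bit to the
following jump, hence its value is irrelevant at the start and unspecified at the end. -/
theorem machineReach_of_reach {n : ℕ} {l l' : Option F.Λ} {s s' : Mem}
    (h : Reach F.code n l s l' s') (i : List Γ) (o : List Bool) (v : Option (Γ ⊕ Bool)) :
    ∃ v', MachineReach n (⟨some (.inr (.inr l)), v, stackFun i o s⟩ : MachineCfg Γ F)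
      ⟨some (.inr (.inr l')), v', stackFun i o s'⟩ := by
  induction h generalizing v with
  | refl => exact ⟨v, rfl⟩
  | @step n l s l' s' _ ih =>
    have h1 : ∃ v₁, TM2.step (machineCode F)
        (⟨some (.inr (.inr (some l))), v, stackFun i o s⟩ : MachineCfg Γ F) =
        some ⟨some (.inr (.inr ((F.code l).next s).1)), v₁, stackFun i o ((F.code l).next s).2⟩ := by
      simp only [TM2.step, machineCode]
      cases F.code l with
      | push k b n =>
        exact ⟨v, congrArg some (stepAux_push_reg _ _ _ _ _ _ _)⟩
      | pop k n =>
        refine ⟨(s.get k).head?.map .inr, ?_⟩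
        rw [instrStmt, stepAux_pop_reg]
        cases h : (s.get k).head? <;> simp [TM2.stepAux, Instr.next, h]
    obtain ⟨v₁, h1⟩ := h1
    obtain ⟨v', h2⟩ := ih v₁
    exact ⟨v', (MachineReach.one h1).trans h2⟩

/-- Pushing the code of a symbol after reading it prepends it to the represented list, so the input
arrives reversed. A symbol takes two steps, since a whole word is pushed in one statement; one more
step detects the end. -/
theorem machineReach_read (i j : List Γ) (v : Option (Γ ⊕ Bool)) :
    ∃ v', MachineReach (2 * i.length + 1)
      (⟨some (.inl false), v, stackFun i [] ⟨(Enc.enc j).code, [], [], [], [], []⟩⟩ : MachineCfg Γ F)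
      ⟨some (.inr (.inr (some F.entry))), v',
        stackFun [] [] ⟨(Enc.enc (i.reverse ++ j)).code, [], [], [], [], []⟩⟩ := by
  induction i generalizing j v with
  | nil =>
    refine ⟨none, MachineReach.one ?_⟩
    rw [TM2.step, machineCode, stepAux_pop_inp]
    rfl
  | cons t i ih =>
    obtain ⟨v', h⟩ := ih (t :: j) (some (.inl t))
    refine ⟨v', ?_⟩
    have h1 : TM2.step (machineCode F) (⟨some (.inl false), v,
        stackFun (t :: i) [] ⟨(Enc.enc j).code, [], [], [], [], []⟩⟩ : MachineCfg Γ F) =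
        some ⟨some (.inr (.inl t)), some (.inl t),
          stackFun i [] ⟨(Enc.enc j).code, [], [], [], [], []⟩⟩ := by
      rw [TM2.step, machineCode, stepAux_pop_inp]
      rfl
    have h2 : TM2.step (machineCode F) (⟨some (.inr (.inl t)), some (.inl t),
        stackFun i [] ⟨(Enc.enc j).code, [], [], [], [], []⟩⟩ : MachineCfg Γ F) =
        some ⟨some (.inl false), some (.inl t),
          stackFun i [] ⟨(Enc.enc (t :: j)).code, [], [], [], [], []⟩⟩ := by
      simp only [TM2.step, machineCode]
      rw [stepAux_pushWord]
      rfl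
    have h3 := ((MachineReach.one h1).trans (MachineReach.one h2)).trans h
    simpa [List.reverse_cons, List.append_assoc, mul_add, add_assoc] using h3

/-- The required halting configuration has empty stacks except for the output, and the initial
internal state. This is why the rest of the code of `true` is popped and the state is reset. -/
theorem machineReach_finish (t : Bool) (v : Option (Γ ⊕ Bool)) :
    MachineReach 1
      (⟨some (.inr (.inr none)), v, stackFun [] [] ⟨(Enc.enc t).code, [], [], [], [], []⟩⟩ :
        MachineCfg Γ F)
      ⟨none, none, stackFun [] [t] ⟨[], [], [], [], [], []⟩⟩ := by
  refine MachineReach.one ?_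
  rw [TM2.step, machineCode, stepAux_pop_reg]
  cases t
  · change some (TM2.stepAux (.push (some none) (fun _ => false) .halt) none
      (stackFun [] [] ⟨[], [], [], [], [], []⟩)) = _
    rw [stepAux_push_out]
    rfl
  · change some (TM2.stepAux (.pop (some (some .m)) (fun v _ => v) (.pop (some (some .m))
      (fun _ _ => none) (.push (some none) (fun _ => true) .halt))) (some (.inr true))
      (stackFun [] [] ⟨[false, false], [], [], [], [], []⟩)) = _
    rw [stepAux_pop_reg, stepAux_pop_reg, stepAux_push_out]
    rfl

open Classical in
/-- Functions that are computed by stack programs in polynomial time yield polynomial time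
decision procedures. -/
theorem PT.decidableInPolyTime {α : Type} [Fintype Γ] {f : List Γ → Bool} (hf : PT f)
    (code : α → List Γ) (P : α → Prop) (h : ∀ x, f (code x).reverse = true ↔ P x) :
    XPathDTD.DecidableInPolyTime code P := by
  obtain ⟨G, T, hG⟩ := hf
  obtain ⟨N, hN⟩ : ∃ N, ∀ t : Γ, esize t ≤ N := by
    refine ⟨∑ t, esize t, fun t => Finset.single_le_sum (f := fun t => esize t) (fun _ _ => Nat.zero_le _) (Finset.mem_univ t)⟩
  have hsize : ∀ l : List Γ, esize l ≤ l.length * (N + 1) + 1 := by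
    intro l
    induction l with
    | nil => simp [esize_nil]
    | cons t l ih =>
      have := hN t
      rw [esize_cons, List.length_cons, Nat.succ_mul]
      omega
  -- Besides the program itself: one step to initialize, two per symbol and one more for reading,
  -- one to finish. The argument of `T` bounds the size of the represented input, `N` being a bound
  -- for its symbols.
  let time : ℕ[X] := T.comp (X * C (N + 1) + C 1) + C 2 * X + C 3
  have key : ∀ x, ∃ n ≤ time.eval (code x).length,
      MachineReach n (⟨some (.inl true), none, stackFun (code x) [] ⟨[], [], [], [], [], []⟩⟩ :
        MachineCfg Γ G) ⟨none, none, stackFun [] [decide (P x)] ⟨[], [], [], [], [], []⟩⟩ := by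
    intro x
    have h1 : MachineReach 1 (⟨some (.inl true), none, stackFun (code x) [] ⟨[], [], [], [], [], []⟩⟩ :
        MachineCfg Γ G) ⟨some (.inl false), none, stackFun (code x) []
          ⟨(Enc.enc ([] : List Γ)).code, [], [], [], [], []⟩⟩ := by
      refine MachineReach.one ?_
      rw [TM2.step, machineCode, stepAux_push_reg]
      rfl
    obtain ⟨v, h2⟩ := machineReach_read (F := G) (code x) [] none
    obtain ⟨k, hk, h3⟩ := hG ((code x).reverse ++ []) [] [] [] [] [] []
    simp only [List.append_nil] at h2 h3 hk
    obtain ⟨v', h3⟩ := machineReach_of_reach h3 ([] : List Γ) [] v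
    have hfx : f (code x).reverse = decide (P x) := by
      rw [Bool.eq_iff_iff, h x, decide_eq_true_iff]
    rw [hfx] at h3
    have h4 := machineReach_finish (F := G) (decide (P x)) v'
    refine ⟨_, ?_, ((h1.trans h2).trans h3).trans h4⟩
    have h5 := eval_le_eval T (hsize (code x).reverse)
    rw [List.length_reverse] at h5
    simp only [time, eval_add, eval_mul, eval_comp, eval_X, eval_C]
    omega
  choose n hn hreach using key
  refine ⟨{ tm := machine Γ G
            inputAlphabet := Equiv.refl _
            outputAlphabet := Equiv.refl _
            time := time
            outputsFun := fun x => ⟨⟨n x, ?_⟩, hn x⟩ }⟩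
  have h1 : initList (machine Γ G) (List.map (Equiv.refl Γ).invFun (code x)) =
      (⟨some (.inl true), none, stackFun (code x) [] ⟨[], [], [], [], [], []⟩⟩ :
        MachineCfg Γ G) := by
    refine congrArg (TM2.Cfg.mk _ _) (funext fun k => ?_)
    rcases k with _ | _ | k
    · exact List.map_id _
    · rfl
    · cases k <;> rfl
  have h2 : haltList (machine Γ G) (List.map (Equiv.refl Bool).invFun
      (Computability.encodeBool (decide (P x)))) =
      (⟨none, none, stackFun [] [decide (P x)] ⟨[], [], [], [], [], []⟩⟩ : MachineCfg Γ G) := by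
    refine congrArg (TM2.Cfg.mk _ _) (funext fun k => ?_)
    rcases k with _ | _ | k
    · rfl
    · exact List.map_id _
    · cases k <;> rfl
  have h3 := hreach x
  unfold MachineReach at h3
  rw [← h1, ← h2] at h3
  exact h3

end StackProgram

namespace StackProgram

namespace PT

open Polynomial

variable {α β γ : Type} [Enc α] [Enc β] [Enc γ]

/-! ### A library of polynomial time functions -/

@[fun_prop]
theorem and {p q : γ → Bool} (hp : PT p) (hq : PT q) : PT fun x => p x && q x := by
  convert hp.ite hq (const false) using 2 with x
  cases p x <;> rfl

@[fun_prop]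
theorem or {p q : γ → Bool} (hp : PT p) (hq : PT q) : PT fun x => p x || q x := by
  convert hp.ite (const true) hq using 2 with x
  cases p x <;> rfl

@[fun_prop]
theorem not {p : γ → Bool} (hp : PT p) : PT fun x => !p x := by
  convert hp.ite (const false) (const true) using 2 with x
  cases p x <;> rfl

@[fun_prop]
theorem headD {l : γ → List α} (hl : PT l) (a : α) : PT fun x => (l x).headD a := by
  convert listCase hl (const a) (g := fun _ b _ => b) (by fun_prop) using 2 with x
  cases l x <;> rfl

@[fun_prop]
theorem tail {l : γ → List α} (hl : PT l) : PT fun x => (l x).tail := by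
  convert listCase hl (const []) (g := fun _ _ t => t) (by fun_prop) using 2 with x
  cases l x <;> rfl

@[fun_prop]
theorem isEmpty {l : γ → List α} (hl : PT l) : PT fun x => (l x).isEmpty := by
  convert listCase hl (const true) (g := fun _ _ _ => false) (by fun_prop) using 2 with x
  cases l x <;> rfl

@[fun_prop]
theorem reverse {l : γ → List α} (hl : PT l) : PT fun x => (l x).reverse := by
  obtain ⟨Q, hQ⟩ := hl.exists_size_le
  have h := foldl hl (const []) (st := fun _ b a => a :: b) (by fun_prop) (Q + C 1)
    (fun x b a ha => by
      have := hQ x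
      have := esize_le_of_mem ha
      rw [esize_cons, eval_add, eval_C]
      omega)
  convert h using 2 with x
  simp [← List.foldr_reverse]

theorem foldr {l : γ → List α} {i : γ → β} {st : γ → α → β → β} (hl : PT l) (hi : PT i)
    (hst : PT fun x : (γ × β) × α => st x.1.1 x.2 x.1.2) (Q : ℕ[X])
    (h : ∀ x b, ∀ a ∈ l x, esize (st x a b) ≤ esize b + Q.eval (esize x)) :
    PT fun x => (l x).foldr (st x) (i x) := by
  convert foldl hl.reverse hi (st := fun x b a => st x a b) hst Q
    (fun x b a ha => h x b a (List.mem_reverse.1 ha)) using 2 with x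
  rw [List.foldl_reverse]

@[fun_prop]
theorem append {l l' : γ → List α} (hl : PT l) (hl' : PT l') : PT fun x => l x ++ l' x := by
  obtain ⟨Q, hQ⟩ := hl.exists_size_le
  convert foldr hl hl' (st := fun _ a b => a :: b) (by fun_prop) (Q + C 1)
    (fun x b a ha => by
      have := hQ x
      have := esize_le_of_mem ha
      rw [esize_cons, eval_add, eval_C]
      omega) using 2 with x
  simp

theorem flatMap {l : γ → List α} {f : γ → α → List β} (hl : PT l)
    (hf : PT fun x : γ × α => f x.1 x.2) : PT fun x => (l x).flatMap (f x) := by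
  obtain ⟨Q, hQ⟩ := hl.exists_size_le
  obtain ⟨Q', hQ'⟩ := hf.exists_size_le
  convert foldr hl (const []) (st := fun x a b => f x a ++ b)
    (append (hf.comp (f := fun x : (γ × List β) × α => (x.1.1, x.2)) (by fun_prop)) (by fun_prop))
    (Q'.comp (X + Q + C 1))
    (fun x b a ha => by
      have h1 := hQ x
      have h2 := esize_le_of_mem ha
      have h3 := hQ' (x, a)
      have h4 := eval_le_eval Q' (m := esize (x, a)) (n := esize x + Q.eval (esize x) + 1)
        (by rw [esize_prod]; simp only; omega)
      have h5 := esize_append (f x a) b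
      simp only [eval_comp, eval_add, eval_X, eval_C]
      simp only at h3
      omega) using 2 with x
  induction l x with
  | nil => rfl
  | cons a t ih => simp [List.flatMap_cons, ih]

theorem map {l : γ → List α} {f : γ → α → β} (hl : PT l)
    (hf : PT fun x : γ × α => f x.1 x.2) : PT fun x => (l x).map (f x) := by
  convert flatMap hl (f := fun x a => [f x a]) (hf.cons (const [])) using 2 with x
  induction l x with
  | nil => rfl
  | cons a t ih => simp [List.flatMap_cons, ih]

theorem filter {l : γ → List α} {p : γ → α → Bool} (hl : PT l)
    (hp : PT fun x : γ × α => p x.1 x.2) : PT fun x => (l x).filter (p x) := by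
  convert flatMap hl (f := fun x a => if p x a then [a] else [])
    (ite hp (by fun_prop) (by fun_prop)) using 2 with x
  induction l x with
  | nil => rfl
  | cons a t ih =>
    rw [List.flatMap_cons, ← ih, List.filter_cons]
    cases p x a <;> rfl

theorem any {l : γ → List α} {p : γ → α → Bool} (hl : PT l)
    (hp : PT fun x : γ × α => p x.1 x.2) : PT fun x => (l x).any (p x) := by
  convert foldr hl (const false) (st := fun x a b => p x a || b)
    (or (hp.comp (f := fun x : (γ × Bool) × α => (x.1.1, x.2)) (by fun_prop)) (by fun_prop)) (C 3)
    (fun x b a _ => by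
      have := esize_bool_le (p x a || b)
      rw [eval_C]
      omega) using 2 with x
  induction l x with
  | nil => rfl
  | cons a t ih => simp [ih]

/-- A function of an element of a finite type is computed by case distinction. -/
theorem finite_cases {τ : Type} [Fintype τ] [Inhabited τ] [Enc τ] [DecidableEq τ] {t : γ → τ}
    {f : τ → γ → β} (ht : ∀ s, PT fun x => decide (t x = s)) (hf : ∀ s, PT (f s)) :
    PT fun x => f (t x) x := by
  have h : ∀ l : List τ, PT fun x => l.foldr (fun s r => if decide (t x = s) then f s x else r)
      (f default x) := by
    intro l
    induction l with
    | nil => exact hf _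
    | cons s l ih => exact ite (ht s) (hf s) ih
  convert h Finset.univ.toList using 2 with x
  have hmem : t x ∈ (Finset.univ : Finset τ).toList := by simp
  revert hmem
  generalize (Finset.univ : Finset τ).toList = l
  intro hmem
  induction l with
  | nil => simp at hmem
  | cons s l ih =>
    by_cases hs : t x = s
    · simp [hs]
    · simp only [List.foldr_cons, hs, decide_false, Bool.false_eq_true, if_false]
      exact ih (by simpa [hs] using hmem)

end PT

/-! ### Equality, membership and prefix tests -/

/-- Types where equality is decided in polynomial time. -/
class EncEq (α : Type) [Enc α] [DecidableEq α] : Prop where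
  pt : PT fun x : α × α => decide (x.1 = x.2)

/-- Membership in a list, as a Boolean. -/
def memB {α : Type} [DecidableEq α] (a : α) (l : List α) : Bool :=
  l.any fun b => decide (a = b)

@[simp]
theorem memB_iff {α : Type} [DecidableEq α] {a : α} {l : List α} :
    memB a l = true ↔ a ∈ l := by
  simp [memB]

/-- The prefix relation between lists, as a Boolean. -/
def prefixB {α : Type} [DecidableEq α] (l l' : List α) : Bool :=
  @List.isPrefixOf α instBEqOfDecidableEq l l'

@[simp]
theorem prefixB_iff {α : Type} [DecidableEq α] {l l' : List α} :
    prefixB l l' = true ↔ l <+: l' :=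
  List.isPrefixOf_iff_prefix

namespace PT

open Polynomial

variable {α β γ : Type} [Enc α] [Enc β] [Enc γ]

@[fun_prop]
theorem decide_eq [DecidableEq α] [EncEq α] {f g : γ → α} (hf : PT f) (hg : PT g) :
    PT fun x => decide (f x = g x) :=
  EncEq.pt.comp (hf.prodMk hg)

@[fun_prop]
theorem memB [DecidableEq α] [EncEq α] {f : γ → α} {l : γ → List α} (hf : PT f)
    (hl : PT l) : PT fun x => StackProgram.memB (f x) (l x) :=
  any hl (p := fun x a => decide (f x = a)) (decide_eq (hf.comp (by fun_prop)) (by fun_prop))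

instance : EncEq Bool where
  pt := by
    convert (fst id).ite (snd id) (snd (α := Bool) id).not using 2 with x
    obtain ⟨_ | _, _ | _⟩ := x <;> rfl

instance [DecidableEq α] [DecidableEq β] [EncEq α] [EncEq β] : EncEq (α × β) where
  pt := by
    have h : PT fun x : (α × β) × (α × β) => decide (x.1.1 = x.2.1) && decide (x.1.2 = x.2.2) := by
      fun_prop
    convert h using 2 with x
    rw [Bool.eq_iff_iff]
    simp [Prod.ext_iff]

-- Folds along `l`, keeping the unread rest of `l'` and a flag. The rest never grows and the flag
-- has size at most 3, which gives the growth bound.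
@[fun_prop]
theorem prefixB [DecidableEq α] [EncEq α] {l l' : γ → List α} (hl : PT l) (hl' : PT l') :
    PT fun x => StackProgram.prefixB (l x) (l' x) := by
  have hst : PT fun x : (γ × List α × Bool) × α => (match x.1.2.1 with
      | [] => ([], false)
      | b :: t => (t, x.1.2.2 && decide (x.2 = b)) : List α × Bool) :=
    listCase (l := fun x : (γ × List α × Bool) × α => x.1.2.1) (f := fun _ => ([], false))
      (g := fun x b t => (t, x.1.2.2 && decide (x.2 = b)))
      (by fun_prop) (by fun_prop) (by fun_prop)
  have h := foldl hl (hl'.prodMk (const true)) (st := fun _ s a => match s.1 with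
      | [] => ([], false)
      | b :: t => (t, s.2 && decide (a = b))) hst (C 3) (fun x s a _ => by
    obtain ⟨s, r⟩ := s
    rw [eval_C]
    cases s with
    | nil =>
      simp only [esize_prod, esize_nil]
      have := esize_bool_le false
      omega
    | cons b t =>
      simp only [esize_prod, esize_cons]
      have := esize_bool_le (r && decide (a = b))
      omega)
  convert h.snd using 2 with x
  have key : ∀ (u v : List α) (r : Bool), (u.foldl (fun (s : List α × Bool) a => match s.1 with
      | [] => ([], false)
      | b :: t => (t, s.2 && decide (a = b))) (v, r)).2 = (r && StackProgram.prefixB u v) := by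
    intro u
    induction u with
    | nil => intro v r; simp [StackProgram.prefixB]
    | cons a u ih =>
      intro v r
      cases v with
      | nil => simp [ih, StackProgram.prefixB]
      | cons b v =>
        rw [List.foldl_cons, ih, StackProgram.prefixB, StackProgram.prefixB, List.isPrefixOf_cons_cons, Bool.and_assoc]
        rfl
  rw [key, Bool.true_and]

instance [DecidableEq α] [EncEq α] : EncEq (List α) where
  pt := by
    have h : PT fun x : List α × List α => StackProgram.prefixB x.1 x.2 && StackProgram.prefixB x.2 x.1 := by
      fun_prop
    convert h using 2 with x
    rw [Bool.eq_iff_iff]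
    simp only [decide_eq_true_iff, Bool.and_eq_true, prefixB_iff]
    exact ⟨fun h => by simp [h], fun h => h.1.eq_of_length_le h.2.length_le⟩

theorem decide_eq_of_enc_eq [DecidableEq α] [DecidableEq β] [EncEq β] (f : α → β)
    (hf : Function.Injective f) (h : ∀ x, Enc.enc (f x) = Enc.enc x) :
    PT fun x : α × α => decide (x.1 = x.2) := by
  convert decide_eq ((of_enc_eq h).comp fst') ((of_enc_eq h).comp snd') using 2 with x
  simp [hf.eq_iff]

instance [DecidableEq α] [EncEq α] : EncEq (Option α) where
  pt := decide_eq_of_enc_eq Option.toList (by rintro (_ | a) (_ | b) h <;> simp_all) fun _ => rfl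

@[fun_prop]
theorem some {f : γ → α} (hf : PT f) : PT fun x => some (f x) :=
  (hf.cons (const [])).congr_enc fun _ => rfl

-- The list is only a clock for the fold; the accumulator holds its own copy, which loses its head
-- in each round. The invariant bounds that copy by the input, hence the growth of the output as
-- well. The empty tail remains at the end and is added separately.
@[fun_prop]
theorem tails {l : γ → List α} (hl : PT l) : PT fun x => (l x).tails := by
  obtain ⟨Q, hQ⟩ := hl.exists_size_le
  have h := foldl_inv hl (hl.prodMk (const [])) (st := fun _ s _ => (s.1.tail, s.1 :: s.2))
    (by fun_prop) (fun x s => esize s.1 ≤ Q.eval (esize x)) (Q + C 1) (fun x => hQ x)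
    (fun x s a _ hs => by
      have h1 : esize s.1.tail ≤ esize s.1 := esize_le_of_sublist (List.tail_sublist _)
      simp only [esize_prod, esize_cons, eval_add, eval_C]
      omega)
  have h' := (h.fst.cons h.snd).reverse
  convert h' using 2 with x
  have key : ∀ (u : List α) (out : List (List α)),
      ((u.foldl (fun (s : List α × List (List α)) _ => (s.1.tail, s.1 :: s.2)) (u, out)).1 ::
      (u.foldl (fun (s : List α × List (List α)) _ => (s.1.tail, s.1 :: s.2)) (u, out)).2) =
      u.tails.reverse ++ out := by
    intro u
    induction u with
    | nil => intro out; rfl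
    | cons a u ih => intro out; simp [ih]
  rw [key]
  simp

end PT

end StackProgram

namespace XPathDTD

open StackProgram Polynomial

set_option synthInstance.maxSize 1000

/-! ### The decision procedure -/

/-- A numbering of the tokens. -/
def Token.index : Token → ℕ
  | bit false => 0
  | bit true => 1
  | endLabel => 2
  | zero => 3
  | epsilon => 4
  | alt => 5
  | cat => 6
  | star => 7
  | self => 8
  | child => 9
  | descendant => 10
  | slash => 11
  | semicolon => 12
  | separator => 13

theorem Token.index_injective : Function.Injective Token.index := by
  rintro (b | _) (b' | _) h <;> (try cases b) <;> (try cases b') <;> first | rfl | cases h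

instance : DecidableEq Token := Token.index_injective.decidableEq

instance : Inhabited Token := ⟨.endLabel⟩

instance : Fintype Token where
  elems := {.bit false, .bit true, .endLabel, .zero, .epsilon, .alt, .cat, .star, .self, .child,
    .descendant, .slash, .semicolon, .separator}
  complete t := by
    rcases t with b | _
    · cases b <;> simp
    all_goals simp

instance : Enc Token where
  enc t := Enc.enc (List.replicate t.index true)

instance : EncEq Token where
  pt := PT.decide_eq_of_enc_eq (fun t => List.replicate t.index true)
    (fun t t' h => Token.index_injective (by simpa using congrArg List.length h)) fun _ => rfl

/-- Labels are given by their binary names. -/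
abbrev Name : Type := List Bool

/-- An atom is a token with a name (which is empty for tokens that need none). -/
abbrev Atom : Type := Token × Name

/-- Add a token in front of a list of atoms. Bits and axes are attached to the label that
follows. -/
def lexStep (t : Token) (l : List Atom) : List Atom :=
  match t with
  | .bit b => ((l.headD default).1, b :: (l.headD default).2) :: l.tail
  | .self => (.self, (l.headD default).2) :: l.tail
  | .child => (.child, (l.headD default).2) :: l.tail
  | .descendant => (.descendant, (l.headD default).2) :: l.tail
  | .slash => l
  | t => (t, []) :: l

/-- Group the tokens into atoms. -/
def lex (ts : List Token) : List Atom := ts.foldr lexStep []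

/-- Split a list of atoms at a token. -/
def splitAtToken (k : Token) (l : List Atom) : List (List Atom) :=
  l.foldr (fun a s => if a.1 = k then [] :: s else (a :: s.headD []) :: s.tail) [[]]

/-- Add an atom in front of a regular expression in prefix notation. The stack holds for each
subexpression whether it accepts a word with symbols in `A`, and whether it accepts a word with
symbols in `A` one of which is in `B`. -/
def regexStep (A B : Name → Bool) (a : Atom) (s : List (Bool × Bool)) : List (Bool × Bool) :=
  let x := s.headD default
  let y := s.tail.headD default
  match a.1 with
  | .endLabel => (A a.2, A a.2 && B a.2) :: s
  | .zero => (false, false) :: s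
  | .epsilon => (true, false) :: s
  | .alt => (x.1 || y.1, x.2 || y.2) :: s.tail.tail
  | .cat => (x.1 && y.1, (x.2 && y.1) || (x.1 && y.2)) :: s.tail.tail
  | .star => (true, x.2) :: s.tail
  | _ => s

/-- Whether a regular expression accepts a word with symbols in `A`, and whether it accepts a word
with symbols in `A` one of which is in `B`. -/
def evalRegex (A B : Name → Bool) (l : List Atom) : Bool × Bool :=
  (l.foldr (regexStep A B) []).headD default

/-- The symbols of the words that are matched against the second path: `none` for the root, and
the names of the labels of the other vertices. -/
abbrev Sym : Type := Option Name

/-- States of the automaton for a list of blocks that have to occur one after the other: the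
remaining blocks, and the longest prefix of the first of them that was just read. -/
abbrev State : Type := List (List Sym) × List Sym

/-- The longest suffix of `v` that is a prefix of `B`. -/
def overlap (B v : List Sym) : List Sym := (v.tails.filter fun u => prefixB u B).headD []

/-- The transition function of the automaton. -/
def State.next (s : State) (c : Sym) : State :=
  let v := overlap (s.1.headD []) (s.2 ++ [c])
  if v = s.1.headD [] then (s.1.tail, []) else (s.1, v)

/-- The prefixes of a list. -/
def prefixes (l : List Sym) : List (List Sym) := l.reverse.tails.map List.reverse

/-- The states that are reachable from the initial state with the given blocks. -/
def states (bs : List (List Sym)) : List State :=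
  bs.tails.flatMap fun cs => (prefixes (cs.headD [])).map fun u => (cs, u)

/-- The state of the translation of a path into blocks: whether the translation has failed, the
current label, the current block, and the finished blocks. -/
abbrev BlockState : Type := Bool × Name × List Sym × List (List Sym)

/-- Translate one step of a path. -/
def blockStep (s : BlockState) (a : Atom) : BlockState :=
  if s.1 then s
  else if a.1 = .self then
    if a.2 = s.2.1 then s else (true, [], [none, none], s.2.2.2)
  else if a.1 = .child then (false, a.2, s.2.2.1 ++ [some a.2], s.2.2.2)
  else (false, a.2, [some a.2], s.2.2.2 ++ [s.2.2.1])

/-- The blocks of a path that starts in a root with the given label. -/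
def blocks (start : Name) (q : List Atom) : List (List Sym) :=
  let s := q.foldl blockStep (false, start, [none], [])
  s.2.2.2 ++ [s.2.2.1]

/-- Facts `(a, s, p)`: there is a tree with root label `a` all paths of which are rejected by the
automaton from state `s`, and which is matched by the steps `p`. -/
abbrev Fact : Type := Name × State × List Atom

/-- The steps that may remain below a child with the given label. -/
def stepsBelow (p : List Atom) (w : Name) : List (List Atom) :=
  match p with
  | [] => []
  | a :: r => (if a.2 = w then [r] else []) ++ (if a.1 = .descendant then [a :: r] else [])

/-- The result of `evalRegex` for the symbols that can be used below a vertex with fact `(s, p)`. -/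
def evalRule (G : List Fact) (s : State) (p : List Atom) (l : List Atom) : Bool × Bool :=
  evalRegex (fun w => memB (w, s.next (some w), []) G)
    (fun w => (stepsBelow p w).any fun p' => memB (w, s.next (some w), p') G) l

/-- Whether a fact follows immediately from the facts in `G`. Each rule consists of the atom of
its label and the atoms of its regular expression. -/
def derivable (rules : List (List Atom)) (G : List Fact) (f : Fact) : Bool :=
  !f.2.1.1.isEmpty &&
    match f.2.2 with
    | [] => rules.any fun r => decide ((r.headD default).2 = f.1) &&
        (evalRule G f.2.1 f.2.2 r.tail).1
    | a :: p =>
      if a.1 = .self then decide (a.2 = f.1) && memB (f.1, f.2.1, p) G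
      else rules.any fun r => decide ((r.headD default).2 = f.1) &&
        (evalRule G f.2.1 f.2.2 r.tail).2

/-- The candidates for facts. -/
def candidates (rules : List (List Atom)) (bs : List (List Sym)) (p : List Atom) : List Fact :=
  rules.flatMap fun r => (states bs).flatMap fun s => p.tails.map fun p' =>
    ((r.headD default).2, s, p')

/-- The derivable facts among the candidates. -/
def facts (rules : List (List Atom)) (U : List Fact) : List Fact :=
  U.foldl (fun G _ => U.filter (derivable rules G)) []

/-- The decision procedure for a start label, rules, and two paths. -/
def decideContained (start : Name) (rules : List (List Atom)) (p q : List Atom) : Bool :=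
  let bs := blocks start q
  !memB (start, State.next (bs, []) none, p) (facts rules (candidates rules bs p))

/-- The decision procedure for a list of tokens. -/
def decideTokens (ts : List Token) : Bool :=
  let l := splitAtToken .separator (lex ts)
  let d := l.headD []
  decideContained (d.headD default).2 (splitAtToken .semicolon d.tail)
    (l.tail.headD []) (l.tail.tail.headD [])

/-! ### The decision procedure works in polynomial time -/

section

variable {γ : Type} [Enc γ]

theorem esize_headD_add_le {α : Type} [Enc α] (l : List α) (a : α) :
    esize (l.headD a) + esize l.tail ≤ esize l + esize a := by
  cases l with
  | nil => simp only [List.headD_nil, List.tail_nil]; omega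
  | cons b l => simp only [List.headD_cons, List.tail_cons, esize_cons]; omega

theorem pt_lexStep : PT fun x : Token × List Atom => lexStep x.1 x.2 := by
  refine PT.finite_cases (t := fun x : Token × List Atom => x.1) (f := fun t x => lexStep t x.2)
    (fun s => by fun_prop) fun s => ?_
  cases s <;> simp only [lexStep] <;> fun_prop

theorem esize_lexStep (t : Token) (l : List Atom) :
    esize (lexStep t l) ≤ esize l + (esize (default : Atom) + 150) := by
  have h := esize_headD_add_le l default
  have h1 := esize_prod (l.headD default)
  have h2 := esize_prod (default : Atom)
  -- A token is represented by a list of at most 13 bits `true`, with four nodes for each and one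
  -- for the end.
  have h3 : ∀ t : Token, esize t < 100 := by
    intro t
    rcases t with b | _
    · cases b <;> decide
    all_goals decide
  have h4 := h3 t
  rcases t with b | _
  · have := esize_bool_le b
    simp only [lexStep, esize_cons, esize_prod]
    omega
  all_goals
    simp only [lexStep, esize_cons, esize_prod, esize_nil]
    omega

@[fun_prop]
theorem pt_lex {ts : γ → List Token} (h : PT ts) : PT fun x => lex (ts x) :=
  PT.foldr (st := fun _ => lexStep) h (.const [])
    (pt_lexStep.comp (f := fun x : (γ × List Atom) × Token => (x.2, x.1.2)) (by fun_prop))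
    (C (esize (default : Atom) + 150)) fun x b a _ => by
      rw [eval_C]
      exact esize_lexStep _ _

@[fun_prop]
theorem pt_splitAtToken (k : Token) {l : γ → List Atom} (hl : PT l) :
    PT fun x => splitAtToken k (l x) := by
  obtain ⟨Q, hQ⟩ := hl.exists_size_le
  have hst : PT fun x : (γ × List (List Atom)) × Atom =>
      if decide (x.2.1 = k) then [] :: x.1.2 else (x.2 :: x.1.2.headD []) :: x.1.2.tail :=
    PT.ite (by fun_prop) (by fun_prop) (by fun_prop)
  simp only [decide_eq_true_eq] at hst
  refine PT.foldr (st := fun _ a s => if a.1 = k then [] :: s else (a :: s.headD []) :: s.tail)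
    hl (.const [[]]) hst (Q + C 5) fun x s a ha => ?_
  have h1 := esize_le_of_mem ha
  have h2 := hQ x
  have h3 := esize_headD_add_le s []
  rw [eval_add, eval_C]
  rw [esize_nil] at h3
  split_ifs
  · rw [esize_cons, esize_nil]; omega
  · rw [esize_cons, esize_cons]; omega

theorem pt_evalRegex {A B : γ → Name → Bool} {l : γ → List Atom}
    (hA : PT fun x : γ × Name => A x.1 x.2) (hB : PT fun x : γ × Name => B x.1 x.2) (hl : PT l) :
    PT fun x => evalRegex (A x) (B x) (l x) := by
  refine PT.headD ?_ _
  refine PT.foldr (st := fun x => regexStep (A x) (B x)) hl (.const []) ?_ (C 20) fun x s a _ => ?_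
  · refine PT.finite_cases (t := fun x : (γ × List (Bool × Bool)) × Atom => x.2.1)
      (f := fun t x => regexStep (A x.1.1) (B x.1.1) (t, x.2.2) x.1.2) (fun s => by fun_prop)
      fun s => ?_
    have hA' : PT fun x : (γ × List (Bool × Bool)) × Atom => A x.1.1 x.2.2 :=
      hA.comp (f := fun x : (γ × List (Bool × Bool)) × Atom => (x.1.1, x.2.2)) (by fun_prop)
    have hB' : PT fun x : (γ × List (Bool × Bool)) × Atom => B x.1.1 x.2.2 :=
      hB.comp (f := fun x : (γ × List (Bool × Bool)) × Atom => (x.1.1, x.2.2)) (by fun_prop)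
    cases s <;> simp only [regexStep] <;> fun_prop
  · have h1 : esize s.tail ≤ esize s := esize_le_of_sublist (List.tail_sublist _)
    have h2 : esize s.tail.tail ≤ esize s.tail := esize_le_of_sublist (List.tail_sublist _)
    have h3 : ∀ y : Bool × Bool, esize y ≤ 7 := fun y => by
      have := esize_bool_le y.1
      have := esize_bool_le y.2
      rw [esize_prod]
      omega
    have h4 : ∀ (y : Bool × Bool) t, esize t ≤ esize s → esize (y :: t) ≤ esize s + 20 :=
      fun y t ht => by
        have := h3 y
        rw [esize_cons]
        omega
    rw [eval_C]
    obtain ⟨t, w⟩ := a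
    cases t <;> simp only [regexStep] <;> first | omega | (apply h4; omega)

@[fun_prop]
theorem pt_overlap {B v : γ → List Sym} (hB : PT B) (hv : PT v) :
    PT fun x => overlap (B x) (v x) := by
  refine PT.headD (PT.filter (p := fun x (u : List Sym) => prefixB u (B x)) (by fun_prop) (by fun_prop)) _

@[fun_prop]
theorem pt_next {s : γ → State} {c : γ → Sym} (hs : PT s) (hc : PT c) :
    PT fun x => (s x).next (c x) := by
  have h : PT fun x => if decide (overlap ((s x).1.headD []) ((s x).2 ++ [c x]) = (s x).1.headD [])
      then ((s x).1.tail, []) else ((s x).1, overlap ((s x).1.headD []) ((s x).2 ++ [c x])) :=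
    PT.ite (by fun_prop) (by fun_prop) (by fun_prop)
  simp only [decide_eq_true_eq] at h
  exact h

@[fun_prop]
theorem pt_states {bs : γ → List (List Sym)} (h : PT bs) : PT fun x => states (bs x) := by
  refine PT.flatMap (f := fun _ cs => (prefixes (cs.headD [])).map fun u => (cs, u)) h.tails ?_
  refine PT.map (f := fun (x : γ × List (List Sym)) (u : List Sym) => (x.2, u)) ?_ (by fun_prop)
  exact PT.map (f := fun _ => List.reverse) (by fun_prop) (by fun_prop)

@[fun_prop]
theorem pt_blocks {start : γ → Name} {q : γ → List Atom} (hs : PT start) (hq : PT q) :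
    PT fun x => blocks (start x) (q x) := by
  obtain ⟨Q, hQ⟩ := hq.exists_size_le
  have hst : PT fun x : (γ × BlockState) × Atom =>
      if x.1.2.1 then x.1.2
      else if decide (x.2.1 = Token.self) then
        if decide (x.2.2 = x.1.2.2.1) then x.1.2 else (true, [], [none, none], x.1.2.2.2.2)
      else if decide (x.2.1 = Token.child) then
        (false, x.2.2, x.1.2.2.2.1 ++ [some x.2.2], x.1.2.2.2.2)
      else (false, x.2.2, [some x.2.2], x.1.2.2.2.2 ++ [x.1.2.2.2.1]) :=
    PT.ite (by fun_prop) (by fun_prop) (PT.ite (by fun_prop)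
      (PT.ite (by fun_prop) (by fun_prop) (by fun_prop))
      (PT.ite (by fun_prop) (by fun_prop) (by fun_prop)))
  simp only [decide_eq_true_eq] at hst
  -- The name of a step can enter the state twice, as current label and in a block; hence the factor
  -- 2.
  have h := PT.foldl (st := fun _ => blockStep) hq
    (i := fun x => (false, start x, [none], [])) (by fun_prop) hst (C 2 * Q + C 50)
    fun x s a ha => by
      have h1 := esize_le_of_mem ha
      have h2 := hQ x
      obtain ⟨k, w⟩ := a
      obtain ⟨f, v, u, out⟩ := s
      have h3 := esize_pos f
      have h5 := esize_pos u
      have h4 := esize_pos v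
      have h6 : esize false = 1 := rfl
      have h7 : esize true = 3 := rfl
      have h8 : esize ([none, none] : List Sym) = 5 := rfl
      have h9 : esize [some w] = esize w + 4 := by
        simp [esize, Enc.enc, encList, Data.size]
      have h10 := esize_append u [some w]
      have h11 := esize_append out [u]
      have h12 : esize [u] = esize u + 2 := rfl
      have h13 : esize ([] : Name) = 1 := rfl
      simp only [blockStep, eval_add, eval_mul, eval_C]
      simp only [esize_prod] at h1
      split_ifs <;> simp only [esize_prod] <;> omega
  have h' := (h.snd.snd.snd).append ((h.snd.snd.fst).cons (.const []))
  exact h'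

@[fun_prop]
theorem pt_evalRule {G : γ → List Fact} {s : γ → State} {p l : γ → List Atom} (hG : PT G)
    (hs : PT s) (hp : PT p) (hl : PT l) : PT fun x => evalRule (G x) (s x) (p x) (l x) := by
  have h3 : PT fun x : γ × Name => p x.1 := hp.comp (by fun_prop)
  refine pt_evalRegex (by fun_prop) ?_ hl
  refine PT.any (l := fun x : γ × Name => stepsBelow (p x.1) x.2)
    (p := fun x p' => memB (x.2, (s x.1).next (some x.2), p') (G x.1)) ?_ ?_
  · have h4 : PT fun x : (Atom × List Atom) × (γ × Name) =>
        (if decide (x.1.1.2 = x.2.2) then [x.1.2] else []) ++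
          (if decide (x.1.1.1 = Token.descendant) then [x.1.1 :: x.1.2] else []) :=
      .append (PT.ite (by fun_prop) (by fun_prop) (by fun_prop))
        (PT.ite (by fun_prop) (by fun_prop) (by fun_prop))
    simp only [decide_eq_true_eq] at h4
    refine (PT.listCase (f := fun _ => []) (g := fun (x : γ × Name) (a : Atom) (r : List Atom) =>
      (if a.2 = x.2 then [r] else []) ++ (if a.1 = .descendant then [a :: r] else []))
      h3 (by fun_prop) h4).congr fun x => ?_
    cases p x.1 <;> simp [stepsBelow]
  · fun_prop

@[fun_prop]
theorem pt_derivable {rules : γ → List (List Atom)} {G : γ → List Fact} {f : γ → Fact}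
    (hr : PT rules) (hG : PT G) (hf : PT f) : PT fun x => derivable (rules x) (G x) (f x) := by
  have hany : ∀ i : Bool × Bool → Bool, PT i → PT fun x => (rules x).any fun r =>
      decide ((r.headD default).2 = (f x).1) && i (evalRule (G x) (f x).2.1 (f x).2.2 r.tail) := by
    intro i hi
    refine PT.any (p := fun x r => decide ((r.headD default).2 = (f x).1) &&
      i (evalRule (G x) (f x).2.1 (f x).2.2 r.tail)) hr ?_
    exact .and (by fun_prop) (hi.comp (by fun_prop))
  refine PT.and (p := fun x => !(f x).2.1.1.isEmpty) (by fun_prop) ?_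
  refine (PT.listCase (l := fun x => (f x).2.2) (g := fun x a p =>
    if decide (a.1 = Token.self) then decide (a.2 = (f x).1) && memB ((f x).1, (f x).2.1, p) (G x)
    else (rules x).any fun r => decide ((r.headD default).2 = (f x).1) &&
      (evalRule (G x) (f x).2.1 (f x).2.2 r.tail).2) (by fun_prop)
    (hany (fun y => y.1) (by fun_prop)) (PT.ite (by fun_prop) (by fun_prop)
      ((hany (fun y => y.2) (by fun_prop)).comp (f := fun x : (Atom × List Atom) × γ => x.2)
      (by fun_prop)))).congr fun x => ?_
  cases h : (f x).2.2 <;> simp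

@[fun_prop]
theorem pt_candidates {rules : γ → List (List Atom)} {bs : γ → List (List Sym)}
    {p : γ → List Atom} (hr : PT rules) (hb : PT bs) (hp : PT p) :
    PT fun x => candidates (rules x) (bs x) (p x) := by
  refine PT.flatMap (f := fun x r => (states (bs x)).flatMap fun s => (p x).tails.map fun p' =>
    ((r.headD default).2, s, p')) hr ?_
  refine PT.flatMap (l := fun x : γ × List Atom => states (bs x.1))
    (f := fun x s => (p x.1).tails.map fun p' => ((x.2.headD default).2, s, p')) ?_ ?_
  · exact (pt_states hb).comp (by fun_prop)
  · refine PT.map (l := fun x : (γ × List Atom) × State => (p x.1.1).tails)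
      (f := fun x p' => ((x.1.2.headD default).2, x.2, p')) ?_ (by fun_prop)
    exact hp.tails.comp (by fun_prop)

-- Every round yields a sublist of the candidates, so the accumulator is never larger than they are.
@[fun_prop]
theorem pt_facts {rules : γ → List (List Atom)} {U : γ → List Fact} (hr : PT rules) (hU : PT U) :
    PT fun x => facts (rules x) (U x) := by
  obtain ⟨Q, hQ⟩ := hU.exists_size_le
  refine PT.foldl (st := fun x G _ => (U x).filter (derivable (rules x) G)) hU (.const []) ?_ Q
    fun x G _ _ => ?_
  · exact PT.filter (l := fun x : (γ × List Fact) × Fact => U x.1.1)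
      (p := fun x => derivable (rules x.1.1) x.1.2) (hU.comp (by fun_prop)) (by fun_prop)
  · have := hQ x
    have := esize_le_of_sublist (List.filter_sublist (p := derivable (rules x) G) (l := U x))
    omega

theorem pt_decideTokens : PT decideTokens := by
  unfold decideTokens decideContained
  fun_prop

end

end XPathDTD

namespace XPathDTD

variable {S : Type}

/-! ### Trees and paths -/

theorem XTree.induction {P : XTree S → Prop}
    (h : ∀ a ts, (∀ t ∈ ts, P t) → P (.node a ts)) : ∀ t, P t
  | .node a ts => h a ts fun t _ => XTree.induction h t
termination_by t => sizeOf t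
decreasing_by
  have := List.sizeOf_lt_of_mem ‹t ∈ ts›
  simp
  omega

theorem XTree.sub_cons (t : XTree S) (i : ℕ) (u : List ℕ) :
    t.sub (i :: u) = (t.children[i]?).bind fun s => s.sub u := by
  rw [XTree.sub]

theorem XTree.sub_nil (t : XTree S) : t.sub [] = some t := by
  rw [XTree.sub]

theorem XTree.sub_append (t : XTree S) (u v : List ℕ) :
    t.sub (u ++ v) = (t.sub u).bind fun s => s.sub v := by
  induction u generalizing t with
  | nil => simp [XTree.sub_nil]
  | cons i u ih =>
    simp only [List.cons_append, XTree.sub_cons, Option.bind_assoc]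
    congr 1
    funext s
    exact ih s

/-- All vertices satisfy the condition of the DTD on their children. -/
def DTD.Valid (d : DTD S) (t : XTree S) : Prop :=
  ∀ (u : List ℕ) (s : XTree S), t.sub u = some s →
    ∃ r : RegularExpression S, (s.label, r) ∈ d.rules ∧ s.children.map XTree.label ∈ r.matches'

theorem DTD.valid_iff (d : DTD S) (t : XTree S) :
    d.Valid t ↔ (∃ r : RegularExpression S, (t.label, r) ∈ d.rules ∧
      t.children.map XTree.label ∈ r.matches') ∧ ∀ c ∈ t.children, d.Valid c := by
  constructor
  · intro h
    refine ⟨h [] t t.sub_nil, fun c hc u s hs => ?_⟩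
    obtain ⟨i, hi⟩ := List.mem_iff_getElem?.1 hc
    exact h (i :: u) s (by rw [XTree.sub_cons, hi]; exact hs)
  · rintro ⟨h1, h2⟩ u s hs
    cases u with
    | nil =>
      rw [XTree.sub_nil] at hs
      cases hs
      exact h1
    | cons i u =>
      rw [XTree.sub_cons, Option.bind_eq_some_iff] at hs
      obtain ⟨c, hc, hs⟩ := hs
      exact h2 c (List.mem_iff_getElem?.2 ⟨i, hc⟩) u s hs

/-- `c` is a subtree of `t` at a vertex other than the root. -/
def XTree.StrictSub (t c : XTree S) : Prop := ∃ u, u ≠ [] ∧ t.sub u = some c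

theorem XTree.strictSub_iff (t c : XTree S) :
    t.StrictSub c ↔ ∃ x ∈ t.children, c = x ∨ x.StrictSub c := by
  constructor
  · rintro ⟨u, hu, h⟩
    obtain ⟨i, u, rfl⟩ := List.exists_cons_of_ne_nil hu
    rw [XTree.sub_cons, Option.bind_eq_some_iff] at h
    obtain ⟨x, hx, h⟩ := h
    refine ⟨x, List.mem_iff_getElem?.2 ⟨i, hx⟩, ?_⟩
    by_cases hu : u = []
    · subst hu
      rw [XTree.sub_nil] at h
      exact .inl (Option.some.inj h).symm
    · exact .inr ⟨u, hu, h⟩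
  · rintro ⟨x, hx, h⟩
    obtain ⟨i, hi⟩ := List.mem_iff_getElem?.1 hx
    rcases h with rfl | ⟨u, _, hu⟩
    · exact ⟨[i], by simp, by rw [XTree.sub_cons, hi]; exact XTree.sub_nil _⟩
    · exact ⟨i :: u, by simp, by rw [XTree.sub_cons, hi]; exact hu⟩

/-- Steps of paths, with the name of the label. -/
abbrev Step : Type := Axis × Name

/-- The atom of a step. -/
def Step.atom (a : Step) : Atom := (encAxis a.1, a.2)

/-- The steps of a path. -/
def LPath.steps (e : S → Name) : LPath S → List Step
  | .step x a => [(x, e a)]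
  | .seq p q => p.steps e ++ q.steps e

/-- The steps can be matched from the root. -/
def StepsMatch (e : S → Name) : List Step → XTree S → Prop
  | [], _ => True
  | (.self, w) :: r, t => e t.label = w ∧ StepsMatch e r t
  | (.child, w) :: r, t => ∃ c ∈ t.children, e c.label = w ∧ StepsMatch e r c
  | (.descendant, w) :: r, t => ∃ c, t.StrictSub c ∧ e c.label = w ∧ StepsMatch e r c

theorem LPath.Sem.isVertex_left {t : XTree S} {p : LPath S} {u v : List ℕ} (h : p.Sem t u v) :
    t.IsVertex u := by
  induction p generalizing u v with
  | step x a => exact h.1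
  | seq p q hp _ =>
    obtain ⟨w, h, _⟩ := h
    exact hp h

theorem LPath.Sem.isVertex_right {t : XTree S} {p : LPath S} {u v : List ℕ} (h : p.Sem t u v) :
    t.IsVertex v := by
  induction p generalizing u v with
  | step x a => exact ⟨_, h.2.1.choose_spec.1⟩
  | seq p q _ hq =>
    obtain ⟨w, _, h⟩ := h
    exact hq h

/-- The steps `rest` to be matched after `p` make the induction work: for a composition, those of
the second path are put in front of `rest`. Only steps that leave from the current vertex matter, so
the subtree there is all that is needed. -/
theorem LPath.exists_sem_iff {e : S → Name} (he : Function.Injective e) {t : XTree S}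
    (p : LPath S) (rest : List Step) {u : List ℕ} {s : XTree S} (hs : t.sub u = some s) :
    (∃ v s', p.Sem t u v ∧ t.sub v = some s' ∧ StepsMatch e rest s') ↔
      StepsMatch e (p.steps e ++ rest) s := by
  induction p generalizing u s rest with
  | step x a =>
    have hsem : ∀ v s', t.sub v = some s' →
        ((LPath.step x a).Sem t u v ↔ e s'.label = e a ∧ x.Rel u v) := by
      intro v s' hv
      constructor
      · rintro ⟨_, ⟨s'', h1, h2⟩, h3⟩
        rw [hv] at h1
        cases h1
        exact ⟨congrArg e h2, h3⟩
      · rintro ⟨h1, h2⟩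
        exact ⟨⟨s, hs⟩, ⟨s', hv, he h1⟩, h2⟩
    have hstep : (∃ v s', (LPath.step x a).Sem t u v ∧ t.sub v = some s' ∧ StepsMatch e rest s') ↔
        ∃ v s', x.Rel u v ∧ t.sub v = some s' ∧ e s'.label = e a ∧ StepsMatch e rest s' := by
      constructor
      · rintro ⟨v, s', h1, h2, h3⟩
        have := (hsem v s' h2).1 h1
        exact ⟨v, s', this.2, h2, this.1, h3⟩
      · rintro ⟨v, s', h1, h2, h3, h4⟩
        exact ⟨v, s', (hsem v s' h2).2 ⟨h3, h1⟩, h2, h4⟩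
    rw [hstep]
    cases x with
    | self =>
      simp only [LPath.steps, List.singleton_append, StepsMatch, Axis.Rel]
      constructor
      · rintro ⟨v, s', rfl, h1, h2⟩
        rw [hs] at h1
        cases h1
        exact h2
      · intro h
        exact ⟨u, s, rfl, hs, h⟩
    | child =>
      simp only [LPath.steps, List.singleton_append, StepsMatch, Axis.Rel]
      constructor
      · rintro ⟨v, s', ⟨i, rfl⟩, h1, h2⟩
        rw [XTree.sub_append, hs, Option.bind_some, XTree.sub_cons, Option.bind_eq_some_iff] at h1
        obtain ⟨c, hc, h1⟩ := h1
        rw [XTree.sub_nil] at h1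
        cases h1
        exact ⟨_, List.mem_iff_getElem?.2 ⟨i, hc⟩, h2⟩
      · rintro ⟨c, hc, h⟩
        obtain ⟨i, hi⟩ := List.mem_iff_getElem?.1 hc
        refine ⟨u ++ [i], c, ⟨i, rfl⟩, ?_, h⟩
        rw [XTree.sub_append, hs, Option.bind_some, XTree.sub_cons, hi]
        exact XTree.sub_nil _
    | descendant =>
      simp only [LPath.steps, List.singleton_append, StepsMatch, Axis.Rel]
      constructor
      · rintro ⟨v, s', ⟨w, hw, rfl⟩, h1, h2⟩
        rw [XTree.sub_append, hs, Option.bind_some] at h1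
        exact ⟨s', ⟨w, hw, h1⟩, h2⟩
      · rintro ⟨c, ⟨w, hw, h1⟩, h2⟩
        refine ⟨u ++ w, c, ⟨w, hw, rfl⟩, ?_, h2⟩
        rw [XTree.sub_append, hs, Option.bind_some, h1]
  | seq p q hp hq =>
    rw [LPath.steps, List.append_assoc, ← hp (q.steps e ++ rest) hs]
    constructor
    · rintro ⟨v, s', ⟨w, h1, h2⟩, h3, h4⟩
      obtain ⟨s'', hs''⟩ := h2.isVertex_left
      exact ⟨w, s'', h1, hs'', (hq rest hs'').1 ⟨v, s', h2, h3, h4⟩⟩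
    · rintro ⟨w, s'', h1, h2, h3⟩
      obtain ⟨v, s', h4, h5, h6⟩ := (hq rest h2).2 h3
      exact ⟨v, s', ⟨w, h1, h4⟩, h5, h6⟩

theorem LPath.holds_iff {e : S → Name} (he : Function.Injective e) (p : LPath S) (t : XTree S) :
    p.Holds t ↔ StepsMatch e (p.steps e) t := by
  have h := p.exists_sem_iff he [] t.sub_nil
  rw [List.append_nil] at h
  rw [← h]
  constructor
  · rintro ⟨v, hv⟩
    obtain ⟨s', hs'⟩ := hv.isVertex_right
    exact ⟨v, s', hv, hs', trivial⟩
  · rintro ⟨v, s', hv, _⟩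
    exact ⟨v, hv⟩

/-! ### Words on branches -/

/-- The word `w` is read on a downward path that starts below the root. -/
def Branch (e : S → Name) : XTree S → List Sym → Prop
  | _, [] => True
  | t, a :: w => ∃ c ∈ t.children, some (e c.label) = a ∧ Branch e c w

/-- The steps can be matched below a vertex with label `c`, along the word `y`. -/
def WordMatch : List Step → Name → List Sym → Prop
  | [], _, _ => True
  | (.self, b) :: r, c, y => c = b ∧ WordMatch r c y
  | (.child, b) :: r, _, y => ∃ y', y = some b :: y' ∧ WordMatch r b y'
  | (.descendant, b) :: r, _, y => ∃ x y', y = x ++ some b :: y' ∧ WordMatch r b y'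

theorem Branch.none_not_mem {e : S → Name} {t : XTree S} {w : List Sym} (h : Branch e t w) :
    none ∉ w := by
  induction w generalizing t with
  | nil => simp
  | cons a w ih =>
    obtain ⟨c, _, rfl, h⟩ := h
    simpa using ih h

theorem branch_append_cons {e : S → Name} {t : XTree S} {b : Name} {x w : List Sym} :
    Branch e t (x ++ some b :: w) → ∃ c, t.StrictSub c ∧ e c.label = b ∧ Branch e c w := by
  induction x generalizing t with
  | nil =>
    rintro ⟨c, hc, h1, h2⟩
    exact ⟨c, (t.strictSub_iff c).2 ⟨c, hc, .inl rfl⟩, by simpa using h1, h2⟩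
  | cons a x ih =>
    rintro ⟨c, hc, _, h2⟩
    obtain ⟨c', h3, h4⟩ := ih h2
    exact ⟨c', (t.strictSub_iff c').2 ⟨c, hc, .inr h3⟩, h4⟩

theorem exists_branch_append {e : S → Name} {t c : XTree S} (h : t.StrictSub c) {w : List Sym}
    (hw : Branch e c w) : ∃ x, Branch e t (x ++ some (e c.label) :: w) := by
  induction t using XTree.induction with
  | h a ts ih =>
    obtain ⟨y, hy, rfl | h⟩ := (XTree.strictSub_iff _ _).1 h
    · exact ⟨[], c, hy, rfl, hw⟩
    · obtain ⟨x, hx⟩ := ih y hy h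
      exact ⟨some (e y.label) :: x, y, hy, rfl, hx⟩

/-- Without filters, a path only ever moves downwards from the vertex it has reached, so the
vertices it visits lie on one branch and the labels along that branch decide. -/
theorem stepsMatch_iff (e : S → Name) (q : List Step) (t : XTree S) :
    StepsMatch e q t ↔ ∃ w, Branch e t w ∧ WordMatch q (e t.label) w := by
  induction q generalizing t with
  | nil => exact ⟨fun _ => ⟨[], trivial, trivial⟩, fun _ => trivial⟩
  | cons a r ih =>
    obtain ⟨x, b⟩ := a
    cases x with
    | self =>
      simp only [StepsMatch, WordMatch, ih]
      exact ⟨fun ⟨h, w, h1, h2⟩ => ⟨w, h1, h, h2⟩, fun ⟨w, h1, h, h2⟩ => ⟨h, w, h1, h2⟩⟩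
    | child =>
      simp only [StepsMatch, WordMatch, ih]
      constructor
      · rintro ⟨c, hc, rfl, w, h1, h2⟩
        exact ⟨some (e c.label) :: w, ⟨c, hc, rfl, h1⟩, w, rfl, h2⟩
      · rintro ⟨_, h, w, rfl, h2⟩
        obtain ⟨c, hc, h, h1⟩ := h
        cases h
        exact ⟨c, hc, rfl, w, h1, h2⟩
    | descendant =>
      simp only [StepsMatch, WordMatch, ih]
      constructor
      · rintro ⟨c, hc, rfl, w, h1, h2⟩
        obtain ⟨x, hx⟩ := exists_branch_append hc h1
        exact ⟨_, hx, x, w, rfl, h2⟩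
      · rintro ⟨_, h1, x, w, rfl, h2⟩
        obtain ⟨c, h3, rfl, h4⟩ := branch_append_cons h1
        exact ⟨c, h3, rfl, w, h4, h2⟩

/-! ### Blocks -/

/-- The blocks occur one after the other in the word. -/
def Occurs : List (List Sym) → List Sym → Prop
  | [], _ => True
  | B :: Bs, w => ∃ x y, w = x ++ (B ++ y) ∧ Occurs Bs y

theorem Occurs.append_left {Bs : List (List Sym)} {w : List Sym} (h : Occurs Bs w)
    (z : List Sym) : Occurs Bs (z ++ w) := by
  cases Bs with
  | nil => trivial
  | cons B Bs =>
    obtain ⟨x, y, rfl, h⟩ := h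
    exact ⟨z ++ x, y, by simp, h⟩

/-- The blocks of a path below a vertex with label `c` that is the end of the block `u`. -/
def blocksFrom (c : Name) (u : List Sym) : List Step → List (List Sym)
  | [] => [u]
  | (.self, b) :: r => if b = c then blocksFrom c u r else [[none, none]]
  | (.child, b) :: r => blocksFrom b (u ++ [some b]) r
  | (.descendant, b) :: r => u :: blocksFrom b [some b] r

theorem foldl_blockStep_failed (s : BlockState) (hs : s.1 = true) (q : List Atom) :
    q.foldl blockStep s = s := by
  induction q with
  | nil => rfl
  | cons a q ih => rw [List.foldl_cons, blockStep, if_pos hs, ih]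

theorem foldl_blockStep (c : Name) (u : List Sym) (out : List (List Sym)) (q : List Step) :
    ((q.map Step.atom).foldl blockStep (false, c, u, out)).2.2.2 ++
      [((q.map Step.atom).foldl blockStep (false, c, u, out)).2.2.1] =
      out ++ blocksFrom c u q := by
  induction q generalizing c u out with
  | nil => rfl
  | cons a q ih =>
    obtain ⟨x, b⟩ := a
    rw [List.map_cons, List.foldl_cons]
    cases x with
    | self =>
      by_cases h : b = c
      · have : blockStep (false, c, u, out) (Step.atom (.self, b)) = (false, c, u, out) := by
          simp [blockStep, Step.atom, encAxis, h]
        rw [this, ih, blocksFrom, if_pos h]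
      · have : blockStep (false, c, u, out) (Step.atom (.self, b)) =
            (true, [], [none, none], out) := by
          simp [blockStep, Step.atom, encAxis, h]
        rw [this, foldl_blockStep_failed _ rfl, blocksFrom, if_neg h]
    | child =>
      have : blockStep (false, c, u, out) (Step.atom (.child, b)) =
          (false, b, u ++ [some b], out) := by
        simp [blockStep, Step.atom, encAxis]
      rw [this, ih, blocksFrom]
    | descendant =>
      have : blockStep (false, c, u, out) (Step.atom (.descendant, b)) =
          (false, b, [some b], out ++ [u]) := by
        simp [blockStep, Step.atom, encAxis]
      rw [this, ih, blocksFrom]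
      simp

theorem blocks_eq (c : Name) (q : List Step) :
    blocks c (q.map Step.atom) = blocksFrom c [none] q :=
  foldl_blockStep c [none] [] q

theorem blocksFrom_ne_nil (c : Name) (u : List Sym) (q : List Step) : blocksFrom c u q ≠ [] := by
  induction q generalizing c u with
  | nil => simp [blocksFrom]
  | cons a q ih =>
    obtain ⟨x, b⟩ := a
    cases x <;> simp only [blocksFrom]
    · split_ifs
      · exact ih _ _
      · simp
    · exact ih _ _
    · simp

theorem ne_nil_of_mem_blocksFrom {c : Name} {u : List Sym} {q : List Step} (hu : u ≠ [])
    {B : List Sym} (hB : B ∈ blocksFrom c u q) : B ≠ [] := by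
  induction q generalizing c u with
  | nil =>
    simp only [blocksFrom, List.mem_singleton] at hB
    rwa [hB]
  | cons a q ih =>
    obtain ⟨x, b⟩ := a
    cases x <;> simp only [blocksFrom] at hB
    · split_ifs at hB
      · exact ih hu hB
      · simp only [List.mem_singleton] at hB
        simp [hB]
    · exact ih (by simp) hB
    · rcases List.mem_cons.1 hB with rfl | hB
      · exact hu
      · exact ih (by simp) hB

/-- A child step fixes the symbol right after `u`, while a descendant step allows any gap, which is
the freedom between consecutive blocks. The hypothesis on `w` makes the block `[none, none]` of a
contradictory self step unmatchable. -/
theorem occurs_blocksFrom (c : Name) (u : List Sym) (q : List Step) (w : List Sym)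
    (hw : ¬ [none, none] <:+: w) :
    Occurs (blocksFrom c u q) w ↔ ∃ x y, w = x ++ (u ++ y) ∧ WordMatch q c y := by
  induction q generalizing c u w with
  | nil => rfl
  | cons a q ih =>
    obtain ⟨x, b⟩ := a
    cases x with
    | self =>
      simp only [blocksFrom, WordMatch]
      by_cases h : b = c
      · rw [if_pos h, ih c u w hw]
        simp [h]
      · rw [if_neg h]
        constructor
        · rintro ⟨x, y, rfl, _⟩
          exact absurd ⟨x, y, by simp⟩ hw
        · rintro ⟨_, _, _, h', _⟩
          exact absurd h'.symm h
    | child =>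
      simp only [blocksFrom, WordMatch]
      rw [ih _ _ w hw]
      constructor
      · rintro ⟨x, y, rfl, h⟩
        exact ⟨x, some b :: y, by simp, y, rfl, h⟩
      · rintro ⟨x, _, rfl, y, rfl, h⟩
        exact ⟨x, y, by simp, h⟩
    | descendant =>
      simp only [blocksFrom, WordMatch, Occurs]
      constructor
      · rintro ⟨x, y, rfl, h⟩
        rw [ih _ _ y fun h => hw (h.trans ⟨x ++ u, [], by simp⟩)] at h
        obtain ⟨x', y', rfl, h⟩ := h
        exact ⟨x, _, rfl, x', y', rfl, h⟩
      · rintro ⟨x, _, rfl, x', y', rfl, h⟩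
        refine ⟨x, _, rfl, (ih _ _ _ fun h => hw (h.trans ⟨x ++ u, [], by simp⟩)).2 ?_⟩
        exact ⟨x', y', rfl, h⟩

/-! ### The automaton -/

theorem overlap_nil (B : List Sym) : overlap B [] = [] := by
  simp only [overlap, List.tails, List.filter]
  split <;> rfl

theorem overlap_cons (B : List Sym) (a : Sym) (v : List Sym) :
    overlap B (a :: v) = if a :: v <+: B then a :: v else overlap B v := by
  simp only [overlap, List.tails, List.filter_cons, StackProgram.prefixB_iff]
  split_ifs <;> rfl

theorem overlap_suffix (B v : List Sym) : overlap B v <:+ v := by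
  induction v with
  | nil => rw [overlap_nil]
  | cons a v ih =>
    rw [overlap_cons]
    split_ifs
    · exact List.suffix_rfl
    · exact ih.trans (List.suffix_cons _ _)

theorem overlap_prefix (B v : List Sym) : overlap B v <+: B := by
  induction v with
  | nil => rw [overlap_nil]; exact List.nil_prefix
  | cons a v ih =>
    rw [overlap_cons]
    split_ifs with h
    · exact h
    · exact ih

/-- Maximality of the overlap: every partial match of `B` at the end of `v` survives in it. -/
theorem suffix_overlap {B v x : List Sym} (hv : x <:+ v) (hB : x <+: B) : x <:+ overlap B v := by
  induction v with
  | nil => rw [overlap_nil]; exact hv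
  | cons a v ih =>
    rw [overlap_cons]
    split_ifs with h
    · exact hv
    · rcases List.suffix_cons_iff.1 hv with rfl | hv
      · exact absurd hB h
      · exact ih hv

/-- Some prefix of the word is accepted from the state. -/
def State.Accepts : State → List Sym → Prop
  | s, [] => s.1 = []
  | s, c :: w => s.1 = [] ∨ (s.next c).Accepts w

/-- Symbols before the overlap may be forgotten. An occurrence of `B` starting in `w` is unaffected.
One that straddles the end of `u ++ [c]` begins with a suffix of `u ++ [c]` that is a prefix of `B`,
and this is a suffix of the overlap. One inside `u ++ [c]` would, as `u` is shorter than `B`, be all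
of it, contrary to `hv`. -/
theorem occurs_overlap {B : List Sym} {Bs : List (List Sym)} {u : List Sym} {c : Sym}
    {w : List Sym} (hu : u <+: B) (hne : u ≠ B) (hv : overlap B (u ++ [c]) ≠ B)
    (h : Occurs (B :: Bs) (u ++ c :: w)) : Occurs (B :: Bs) (overlap B (u ++ [c]) ++ w) := by
  obtain ⟨z, hz⟩ := overlap_suffix B (u ++ [c])
  obtain ⟨x, y, hxy, h⟩ := h
  have hlen : u.length < B.length := by
    refine lt_of_le_of_ne hu.length_le fun h => hne (hu.eq_of_length h)
  have h0 : u ++ c :: w = (u ++ [c]) ++ w := by simp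
  rw [h0] at hxy
  rcases List.append_eq_append_iff.1 hxy with ⟨r, hr1, hr2⟩ | ⟨r, hr1, hr2⟩
  · refine Occurs.append_left (w := w) ?_ _
    exact ⟨r, y, hr2, h⟩
  · rcases List.append_eq_append_iff.1 hr2 with ⟨r', h1, h2⟩ | ⟨r', h1, h2⟩
    · exfalso
      have hl := congrArg List.length hr1
      simp only [List.length_append, List.length_singleton, h1] at hl
      have hx : x = [] := List.eq_nil_of_length_eq_zero (by omega)
      have hr' : r' = [] := List.eq_nil_of_length_eq_zero (by omega)
      subst hx hr'
      rw [List.append_nil] at h1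
      rw [List.nil_append] at hr1
      apply hv
      rw [hr1, h1]
      exact List.IsSuffix.eq_of_length_le (overlap_suffix _ _)
        (suffix_overlap List.suffix_rfl List.prefix_rfl).length_le
    · have h3 := suffix_overlap (B := B) (v := u ++ [c]) (x := r) ⟨x, hr1.symm⟩ ⟨r', h1.symm⟩
      obtain ⟨r'', hr''⟩ := h3
      refine ⟨r'', y, ?_, h⟩
      rw [← hr'', h2, h1]
      simp

/-- Correctness of the greedy search: taking the first occurrence of each block leaves the longest
remainder for the others. The hypotheses say that the current block is only partially read, which an
empty block would violate. -/
theorem accepts_iff (s : State) (w : List Sym) (hs : ∀ B ∈ s.1, B ≠ [])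
    (hu : s.1 ≠ [] → s.2 <+: s.1.headD [] ∧ s.2 ≠ s.1.headD []) :
    s.Accepts w ↔ Occurs s.1 (s.2 ++ w) := by
  induction w generalizing s with
  | nil =>
    obtain ⟨_ | ⟨B, Bs⟩, u⟩ := s
    · simp [State.Accepts, Occurs]
    · obtain ⟨h1, h2⟩ := hu (by simp)
      simp only [State.Accepts, List.append_nil, Occurs, reduceCtorEq, false_iff]
      rintro ⟨x, y, rfl, _⟩
      refine h2 (h1.eq_of_length_le ?_)
      simp
      omega
  | cons c w ih =>
    obtain ⟨_ | ⟨B, Bs⟩, u⟩ := s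
    · simp [State.Accepts, Occurs]
    · obtain ⟨h1, h2⟩ := hu (by simp)
      simp only [List.headD_cons] at h1 h2
      simp only [State.Accepts, reduceCtorEq, false_or]
      by_cases hv : overlap B (u ++ [c]) = B
      · have hn : State.next (B :: Bs, u) c = (Bs, []) := by
          simp [State.next, hv]
        have hB : u ++ [c] = B := by
          have h3 := overlap_suffix B (u ++ [c])
          rw [hv] at h3
          refine (h3.eq_of_length_le ?_).symm
          have : u.length < B.length :=
            lt_of_le_of_ne h1.length_le fun h => h2 (h1.eq_of_length h)
          simp
          omega
        rw [hn, ih _ (fun B' hB' => hs B' (List.mem_cons_of_mem _ hB')) ?_]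
        · have hw : u ++ c :: w = B ++ w := by rw [← hB]; simp
          simp only [List.nil_append, hw, Occurs]
          constructor
          · intro h
            exact ⟨[], w, rfl, h⟩
          -- Any occurrence of `B` in `B ++ w` ends no earlier than the one at the beginning, so
          -- what follows it is a suffix of `w`.
          · rintro ⟨x, y, hxy, h⟩
            have hl := congrArg List.length hxy
            simp only [List.length_append] at hl
            have hsuf : y <:+ w := by
              refine List.suffix_of_suffix_length_le (l₃ := B ++ w) ?_ (List.suffix_append _ _)
                (by omega)
              rw [hxy]
              exact ⟨x ++ B, by simp⟩
            obtain ⟨z, rfl⟩ := hsuf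
            exact h.append_left z
        · intro hne
          obtain ⟨B', Bs', rfl⟩ := List.exists_cons_of_ne_nil hne
          exact ⟨List.nil_prefix, (hs B' (by simp)).symm⟩
      · have hn : State.next (B :: Bs, u) c = (B :: Bs, overlap B (u ++ [c])) := by
          simp [State.next, hv]
        rw [hn, ih (B :: Bs, overlap B (u ++ [c])) hs fun _ => ⟨overlap_prefix _ _, hv⟩]
        constructor
        · intro h
          obtain ⟨z, hz⟩ := overlap_suffix B (u ++ [c])
          have := h.append_left z
          simp only [← List.append_assoc, hz] at this
          simpa using this
        · exact occurs_overlap h1 h2 hv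

theorem mem_states {bs : List (List Sym)} {s : State} :
    s ∈ states bs ↔ s.1 <:+ bs ∧ s.2 <+: s.1.headD [] := by
  obtain ⟨cs, u⟩ := s
  simp only [states, prefixes, List.mem_flatMap, List.mem_tails, List.mem_map]
  constructor
  · rintro ⟨cs', h1, v, ⟨v', h2, rfl⟩, h3⟩
    cases h3
    refine ⟨h1, ?_⟩
    rw [← List.reverse_suffix, List.reverse_reverse]
    exact h2
  · rintro ⟨h1, h2⟩
    refine ⟨cs, h1, u, ⟨u.reverse, List.reverse_suffix.2 h2, List.reverse_reverse u⟩, rfl⟩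

theorem next_mem_states {bs : List (List Sym)} {s : State} (hs : s ∈ states bs) (c : Sym) :
    s.next c ∈ states bs := by
  rw [mem_states] at *
  simp only [State.next]
  split_ifs
  · exact ⟨(List.tail_suffix _).trans hs.1, List.nil_prefix⟩
  · exact ⟨hs.1, overlap_prefix _ _⟩

/-- No branch of the tree is accepted from the state. -/
def Avoids (e : S → Name) (s : State) (t : XTree S) : Prop := ∀ w, Branch e t w → ¬ s.Accepts w

/-- The automaton is deterministic, so all branches through a child continue from the same state and
can be treated together. -/
theorem avoids_iff (e : S → Name) (s : State) (t : XTree S) :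
    Avoids e s t ↔ s.1 ≠ [] ∧ ∀ c ∈ t.children, Avoids e (s.next (some (e c.label))) c := by
  constructor
  · intro h
    exact ⟨h [] trivial, fun c hc w hw hacc => h (some (e c.label) :: w) ⟨c, hc, rfl, hw⟩
      (.inr hacc)⟩
  · rintro ⟨h1, h2⟩ w hw
    cases w with
    | nil => exact h1
    | cons a w =>
      obtain ⟨c, hc, rfl, hw⟩ := hw
      rintro (h | h)
      · exact h1 h
      · exact h2 c hc w hw h

theorem avoids_blocks_iff (e : S → Name) (q : List Step) (t : XTree S) :
    Avoids e (State.next (blocks (e t.label) (q.map Step.atom), []) none) t ↔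
      ¬ StepsMatch e q t := by
  rw [blocks_eq, stepsMatch_iff, not_exists]
  refine forall_congr' fun w => ?_
  rw [not_and]
  refine forall_congr' fun hw => not_congr ?_
  have hnone := hw.none_not_mem
  -- The symbol `none` is read at the root and never on a branch below it. For the same reason the
  -- first block can only occur at the beginning.
  have hinf : ¬ [none, none] <:+: none :: w := by
    rintro ⟨x, y, h⟩
    cases x with
    | nil =>
      simp only [List.nil_append, List.cons_append, List.cons.injEq, true_and] at h
      exact hnone (by simp [← h])
    | cons a x =>
      simp only [List.cons_append, List.cons.injEq] at h
      exact hnone (by simp [← h.2])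
  have hacc := accepts_iff (blocksFrom (e t.label) [none] q, []) (none :: w)
    (fun B hB => ne_nil_of_mem_blocksFrom (by simp) hB) (by
      intro hne
      obtain ⟨B, Bs, hB⟩ := List.exists_cons_of_ne_nil hne
      have hB' : blocksFrom (e t.label) [none] q = B :: Bs := hB
      refine ⟨List.nil_prefix, ?_⟩
      change [] ≠ (blocksFrom (e t.label) [none] q).headD []
      rw [hB', List.headD_cons]
      exact (ne_nil_of_mem_blocksFrom (c := e t.label) (u := [none]) (q := q) (B := B) (by simp)
        (by simp [hB'])).symm)
  simp only [State.Accepts, blocksFrom_ne_nil, false_or, List.nil_append] at hacc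
  rw [hacc, occurs_blocksFrom _ _ _ _ hinf]
  constructor
  · rintro ⟨x, y, hxy, h⟩
    cases x with
    | nil =>
      simp only [List.nil_append, List.singleton_append, List.cons.injEq, true_and] at hxy
      rwa [hxy]
    | cons a x =>
      simp only [List.cons_append, List.cons.injEq] at hxy
      exact absurd (by simp [hxy.2]) hnone
  · intro h
    exact ⟨[], w, rfl, h⟩

end XPathDTD

namespace XPathDTD

open StackProgram

set_option synthInstance.maxSize 1000

variable {S : Type}

/-! ### Regular expressions -/

/-- The atoms of a regular expression, in prefix notation. -/
def regexAtoms (e : S → Name) : RegularExpression S → List Atom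
  | .zero => [(.zero, [])]
  | .epsilon => [(.epsilon, [])]
  | .char a => [(.endLabel, e a)]
  | .plus r s => (.alt, []) :: (regexAtoms e r ++ regexAtoms e s)
  | .comp r s => (.cat, []) :: (regexAtoms e r ++ regexAtoms e s)
  | .star r => (.star, []) :: regexAtoms e r

/-- Prefix notation is evaluated from the right with a stack; the arbitrary `st` makes this
compositional. The marked letter of a concatenation lies in one of the two factors, and a marked
iterate contains a marked factor that by itself belongs to the star. -/
theorem foldr_regexStep (e : S → Name) (A B : Name → Bool) (r : RegularExpression S)
    (st : List (Bool × Bool)) :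
    ∃ n b : Bool, (regexAtoms e r).foldr (regexStep A B) st = (n, b) :: st ∧
      (n = true ↔ ∃ w ∈ r.matches', ∀ c ∈ w, A (e c) = true) ∧
      (b = true ↔ ∃ w ∈ r.matches', (∀ c ∈ w, A (e c) = true) ∧ ∃ c ∈ w, B (e c) = true) := by
  induction r generalizing st with
  | zero =>
    refine ⟨false, false, rfl, ?_, ?_⟩
    · simp only [Bool.false_eq_true, false_iff]
      rintro ⟨w, hw, _⟩
      exact hw
    · simp only [Bool.false_eq_true, false_iff]
      rintro ⟨w, hw, _⟩
      exact hw
  | epsilon =>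
    refine ⟨true, false, rfl, ?_, ?_⟩
    · simp only [true_iff]
      exact ⟨[], Language.nil_mem_one, by simp⟩
    · simp only [Bool.false_eq_true, false_iff]
      rintro ⟨w, hw, _, c, hc, _⟩
      have : w = [] := hw
      simp [this] at hc
  | char a =>
    refine ⟨A (e a), A (e a) && B (e a), rfl, ?_, ?_⟩
    · constructor
      · intro h
        exact ⟨[a], rfl, by simpa using h⟩
      · rintro ⟨w, hw, h⟩
        have : w = [a] := hw
        exact h a (by simp [this])
    · rw [Bool.and_eq_true]
      constructor
      · rintro ⟨h, h'⟩
        exact ⟨[a], rfl, by simpa using h, by simpa using h'⟩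
      · rintro ⟨w, hw, h, c, hc, h'⟩
        have : w = [a] := hw
        subst this
        rw [List.mem_singleton] at hc
        subst hc
        exact ⟨h c (by simp), h'⟩
  | plus r s hr hs =>
    obtain ⟨n₂, b₂, h₂, hn₂, hb₂⟩ := hs st
    obtain ⟨n₁, b₁, h₁, hn₁, hb₁⟩ := hr ((n₂, b₂) :: st)
    refine ⟨n₁ || n₂, b₁ || b₂, ?_, ?_, ?_⟩
    · rw [regexAtoms, List.foldr_cons, List.foldr_append, h₂, h₁]
      rfl
    · rw [Bool.or_eq_true, hn₁, hn₂, ← exists_or]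
      refine exists_congr fun w => ?_
      rw [← or_and_right]
      exact Iff.rfl
    · rw [Bool.or_eq_true, hb₁, hb₂, ← exists_or]
      refine exists_congr fun w => ?_
      rw [← or_and_right]
      exact Iff.rfl
  | comp r s hr hs =>
    obtain ⟨n₂, b₂, h₂, hn₂, hb₂⟩ := hs st
    obtain ⟨n₁, b₁, h₁, hn₁, hb₁⟩ := hr ((n₂, b₂) :: st)
    have hmem : ∀ w, w ∈ (RegularExpression.comp r s).matches' ↔
        ∃ x ∈ r.matches', ∃ y ∈ s.matches', x ++ y = w := fun w => Language.mem_mul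
    refine ⟨n₁ && n₂, (b₁ && n₂) || (n₁ && b₂), ?_, ?_, ?_⟩
    · rw [regexAtoms, List.foldr_cons, List.foldr_append, h₂, h₁]
      rfl
    · rw [Bool.and_eq_true, hn₁, hn₂]
      constructor
      · rintro ⟨⟨x, hx, hx'⟩, y, hy, hy'⟩
        refine ⟨x ++ y, (hmem _).2 ⟨x, hx, y, hy, rfl⟩, fun c hc => ?_⟩
        exact (List.mem_append.1 hc).elim (hx' c) (hy' c)
      · rintro ⟨w, hw, h⟩
        obtain ⟨x, hx, y, hy, rfl⟩ := (hmem _).1 hw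
        exact ⟨⟨x, hx, fun c hc => h c (by simp [hc])⟩, y, hy, fun c hc => h c (by simp [hc])⟩
    · rw [Bool.or_eq_true, Bool.and_eq_true, Bool.and_eq_true, hn₁, hn₂, hb₁, hb₂]
      constructor
      · rintro (⟨⟨x, hx, hx', c, hc, hB⟩, y, hy, hy'⟩ | ⟨⟨x, hx, hx'⟩, y, hy, hy', c, hc, hB⟩)
        · exact ⟨x ++ y, (hmem _).2 ⟨x, hx, y, hy, rfl⟩,
            fun c hc => (List.mem_append.1 hc).elim (hx' c) (hy' c), c, by simp [hc], hB⟩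
        · exact ⟨x ++ y, (hmem _).2 ⟨x, hx, y, hy, rfl⟩,
            fun c hc => (List.mem_append.1 hc).elim (hx' c) (hy' c), c, by simp [hc], hB⟩
      · rintro ⟨w, hw, h, c, hc, hB⟩
        obtain ⟨x, hx, y, hy, rfl⟩ := (hmem _).1 hw
        have hx' : ∀ c ∈ x, A (e c) = true := fun c hc => h c (by simp [hc])
        have hy' : ∀ c ∈ y, A (e c) = true := fun c hc => h c (by simp [hc])
        rcases List.mem_append.1 hc with hc | hc
        · exact .inl ⟨⟨x, hx, hx', c, hc, hB⟩, y, hy, hy'⟩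
        · exact .inr ⟨⟨x, hx, hx'⟩, y, hy, hy', c, hc, hB⟩
  | star r hr =>
    obtain ⟨n, b, h, hn, hb⟩ := hr st
    have hmem : ∀ w, w ∈ (RegularExpression.star r).matches' ↔
        ∃ L : List (List S), w = L.flatten ∧ ∀ y ∈ L, y ∈ r.matches' :=
      fun w => Language.mem_kstar
    refine ⟨true, b, ?_, ?_, ?_⟩
    · rw [regexAtoms, List.foldr_cons, h]
      rfl
    · simp only [true_iff]
      exact ⟨[], (hmem _).2 ⟨[], rfl, by simp⟩, by simp⟩
    · rw [hb]
      constructor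
      · rintro ⟨w, hw, h⟩
        exact ⟨w, (hmem _).2 ⟨[w], by simp, by simpa using hw⟩, h⟩
      · rintro ⟨w, hw, h, c, hc, hB⟩
        obtain ⟨L, rfl, hL⟩ := (hmem _).1 hw
        obtain ⟨y, hy, hc⟩ := List.mem_flatten.1 hc
        exact ⟨y, hL y hy, fun c hc => h c (List.mem_flatten.2 ⟨y, hy, hc⟩), c, hc, hB⟩

theorem evalRegex_fst (e : S → Name) (A B : Name → Bool) (r : RegularExpression S) :
    (evalRegex A B (regexAtoms e r)).1 = true ↔ ∃ w ∈ r.matches', ∀ c ∈ w, A (e c) = true := by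
  obtain ⟨n, b, h, hn, _⟩ := foldr_regexStep e A B r []
  rw [evalRegex, h]
  exact hn

theorem evalRegex_snd (e : S → Name) (A B : Name → Bool) (r : RegularExpression S) :
    (evalRegex A B (regexAtoms e r)).2 = true ↔
      ∃ w ∈ r.matches', (∀ c ∈ w, A (e c) = true) ∧ ∃ c ∈ w, B (e c) = true := by
  obtain ⟨n, b, h, _, hb⟩ := foldr_regexStep e A B r []
  rw [evalRegex, h]
  exact hb

/-! ### Facts -/

/-- The rules of a DTD as lists of atoms. -/
def DTD.ruleAtoms (e : S → Name) (d : DTD S) : List (List Atom) :=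
  d.rules.map (fun x => (.endLabel, e x.1) :: regexAtoms e x.2) ++ [[]]

/-- Splitting after the last semicolon leaves an empty rule. Its default label may coincide with a
real one, but it contributes nothing because the empty expression evaluates to the default pair, on
which `i` is false. -/
theorem any_ruleAtoms (e : S → Name) (d : DTD S) (G : List Fact) (s : State) (p : List Atom)
    (a : Name) (i : Bool × Bool → Bool) (hi : i default = false) :
    (d.ruleAtoms e).any (fun r => decide ((r.headD default).2 = a) && i (evalRule G s p r.tail)) =
      true ↔ ∃ x ∈ d.rules, e x.1 = a ∧ i (evalRule G s p (regexAtoms e x.2)) = true := by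
  have h : i (evalRule G s p []) = false := hi
  simp only [DTD.ruleAtoms, List.any_append, List.any_map, Bool.or_eq_true, List.any_eq_true]
  simp only [Function.comp_apply, List.headD_cons, List.tail_cons, Bool.and_eq_true,
    decide_eq_true_eq, List.mem_singleton, exists_eq_left, List.tail_nil, h, Bool.false_eq_true,
    and_false, or_false]
  exact exists_congr fun x => and_congr_right fun _ => and_congr_left fun _ => decide_eq_true_iff

theorem map_label_map {T : S → XTree S} {w : List S} (h : ∀ c ∈ w, (T c).label = c) :
    (w.map T).map XTree.label = w := by
  rw [List.map_map]
  exact (List.map_congr_left h).trans (List.map_id _)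

/-- The meaning of facts. -/
def Fact.Holds (e : S → Name) (d : DTD S) (f : Fact) : Prop :=
  ∃ t : XTree S, e t.label = f.1 ∧ d.Valid t ∧ Avoids e f.2.1 t ∧
    ∀ p : List Step, p.map Step.atom = f.2.2 → StepsMatch e p t

/-! ### Soundness of the derived facts -/

theorem exists_children {e : S → Name} (he : Function.Injective e) {d : DTD S} {G : List Fact}
    (hG : ∀ f ∈ G, f.Holds e d) {s : State} {w : List S}
    (hw : ∀ c ∈ w, memB (e c, s.next (some (e c)), []) G = true) :
    ∃ T : S → XTree S, ∀ c ∈ w, (T c).label = c ∧ d.Valid (T c) ∧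
      Avoids e (s.next (some (e c))) (T c) := by
  have h : ∀ c, ∃ t : XTree S, c ∈ w → t.label = c ∧ d.Valid t ∧
      Avoids e (s.next (some (e c))) t := by
    intro c
    by_cases hc : c ∈ w
    · obtain ⟨t, h1, h2, h3, _⟩ := hG _ (memB_iff.1 (hw c hc))
      exact ⟨t, fun _ => ⟨he h1, h2, h3⟩⟩
    · exact ⟨.node c [], fun h => absurd h hc⟩
  choose T hT using h
  exact ⟨T, hT⟩

/-- The witnesses of the facts used become the children of a new root, in the order of the word
accepted by the regular expression. For a self step the old witness is kept. -/
theorem derivable_sound {e : S → Name} (he : Function.Injective e) {d : DTD S} {G : List Fact}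
    (hG : ∀ f ∈ G, f.Holds e d) {f : Fact} (hf : derivable (d.ruleAtoms e) G f = true) :
    f.Holds e d := by
  obtain ⟨a, s, pa⟩ := f
  have hs : s.1 ≠ [] := by
    simp only [derivable, Bool.and_eq_true, Bool.not_eq_true', List.isEmpty_eq_false_iff] at hf
    exact hf.1
  cases pa with
  | nil =>
    simp only [derivable, Bool.and_eq_true] at hf
    obtain ⟨⟨b, r⟩, hr, rfl, hev⟩ := (any_ruleAtoms e d G s [] a (fun y => y.1) rfl).1 hf.2
    obtain ⟨w, hw, hwG⟩ := (evalRegex_fst e _ _ r).1 hev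
    obtain ⟨T, hT⟩ := exists_children he hG hwG
    refine ⟨.node b (w.map T), rfl, (d.valid_iff _).2 ⟨⟨r, hr, ?_⟩, ?_⟩,
      (avoids_iff _ _ _).2 ⟨hs, ?_⟩, ?_⟩
    · rw [XTree.children, map_label_map fun c hc => (hT c hc).1]
      exact hw
    · intro c hc
      obtain ⟨b', hb', rfl⟩ := List.mem_map.1 hc
      exact (hT b' hb').2.1
    · intro c hc
      obtain ⟨b', hb', rfl⟩ := List.mem_map.1 hc
      have := (hT b' hb').2.2
      rwa [(hT b' hb').1]
    · intro p hp
      rw [List.map_eq_nil_iff.1 hp]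
      trivial
  | cons a' pa =>
    obtain ⟨k, b'⟩ := a'
    simp only [derivable, Bool.and_eq_true] at hf
    by_cases hk : k = .self
    · subst hk
      simp only [if_true, Bool.and_eq_true, decide_eq_true_eq] at hf
      obtain ⟨_, rfl, hmem⟩ := hf
      obtain ⟨t, h1, h2, h3, h4⟩ := hG _ (memB_iff.1 hmem)
      refine ⟨t, h1, h2, h3, fun p hp => ?_⟩
      obtain ⟨⟨x, b⟩, p', rfl, hx, hp'⟩ := List.map_eq_cons_iff.1 hp
      cases x <;> cases hx
      exact ⟨h1, h4 p' hp'⟩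
    · simp only [if_neg hk] at hf
      obtain ⟨⟨b, r⟩, hr, rfl, hev⟩ := (any_ruleAtoms e d G s _ a (fun y => y.2) rfl).1 hf.2
      obtain ⟨w, hw, hwG, c₀, hc₀, hB⟩ := (evalRegex_snd e _ _ r).1 hev
      obtain ⟨T, hT⟩ := exists_children he hG hwG
      obtain ⟨p', hp', hmem⟩ := List.any_eq_true.1 hB
      obtain ⟨t₀, h1, h2, h3, h4⟩ := hG _ (memB_iff.1 hmem)
      simp only at h1 h3 h4
      -- Only one occurrence of the marked letter receives the tree `t₀` that carries the remaining
      -- steps; its other occurrences receive the trees given by `T`.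
      obtain ⟨w₁, w₂, rfl⟩ := List.append_of_mem hc₀
      have hch : ∀ c ∈ w₁.map T ++ t₀ :: w₂.map T, d.Valid c ∧
          Avoids e (s.next (some (e c.label))) c := by
        intro c hc
        rcases List.mem_append.1 hc with hc | hc
        · obtain ⟨y, hy, rfl⟩ := List.mem_map.1 hc
          have := hT y (by simp [hy])
          exact ⟨this.2.1, by rw [this.1]; exact this.2.2⟩
        · rcases List.mem_cons.1 hc with rfl | hc
          · exact ⟨h2, by rw [h1]; exact h3⟩
          · obtain ⟨y, hy, rfl⟩ := List.mem_map.1 hc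
            have := hT y (by simp [hy])
            exact ⟨this.2.1, by rw [this.1]; exact this.2.2⟩
      refine ⟨.node b (w₁.map T ++ t₀ :: w₂.map T), rfl, (d.valid_iff _).2 ⟨⟨r, hr, ?_⟩,
        fun c hc => (hch c hc).1⟩, (avoids_iff _ _ _).2 ⟨hs, fun c hc => (hch c hc).2⟩, ?_⟩
      · have h₁ : (w₁.map T).map XTree.label = w₁ :=
          map_label_map fun c hc => (hT c (by simp [hc])).1
        have h₂ : (w₂.map T).map XTree.label = w₂ :=
          map_label_map fun c hc => (hT c (by simp [hc])).1
        rw [XTree.children, List.map_append, List.map_cons, h₁, h₂, he h1]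
        exact hw
      · intro p hp
        obtain ⟨⟨x, b''⟩, p'', rfl, hx, rfl⟩ := List.map_eq_cons_iff.1 hp
        have ht₀ : t₀ ∈ (XTree.node b (w₁.map T ++ t₀ :: w₂.map T)).children := by
          simp [XTree.children]
        cases hx
        simp only [stepsBelow, List.mem_append] at hp'
        cases x with
        | self => exact absurd rfl hk
        | child =>
          rcases hp' with hp' | hp'
          · split_ifs at hp' with hb
            · rw [List.mem_singleton] at hp'
              exact ⟨t₀, ht₀, h1.trans hb.symm, h4 p'' hp'.symm⟩
            · simp at hp'
          · simp [encAxis] at hp'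
        | descendant =>
          rcases hp' with hp' | hp'
          · split_ifs at hp' with hb
            · rw [List.mem_singleton] at hp'
              exact ⟨t₀, (XTree.strictSub_iff _ _).2 ⟨t₀, ht₀, .inl rfl⟩, h1.trans hb.symm,
                h4 p'' hp'.symm⟩
            · simp at hp'
          · simp only [encAxis, if_true, List.mem_singleton] at hp'
            obtain ⟨c, hc, hc'⟩ := h4 ((.descendant, b'') :: p'') hp'.symm
            exact ⟨c, (XTree.strictSub_iff _ _).2 ⟨t₀, ht₀, .inr hc⟩, hc'⟩

theorem facts_sound {e : S → Name} (he : Function.Injective e) (d : DTD S) (U : List Fact) :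
    ∀ f ∈ facts (d.ruleAtoms e) U, f.Holds e d := by
  have h : ∀ (l G : List Fact), (∀ f ∈ G, f.Holds e d) →
      ∀ f ∈ l.foldl (fun G _ => U.filter (derivable (d.ruleAtoms e) G)) G, f.Holds e d := by
    intro l
    induction l with
    | nil => exact fun G hG => hG
    | cons a l ih =>
      exact fun G hG => ih _ fun f hf => derivable_sound he hG (List.mem_filter.1 hf).2
  exact h U [] (by simp)

/-! ### Monotonicity, the fixed point, and completeness -/

theorem evalRule_mono {G G' : List Fact} (h : G ⊆ G') (e : S → Name) (s : State) (p : List Atom)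
    (r : RegularExpression S) :
    ((evalRule G s p (regexAtoms e r)).1 = true → (evalRule G' s p (regexAtoms e r)).1 = true) ∧
    ((evalRule G s p (regexAtoms e r)).2 = true → (evalRule G' s p (regexAtoms e r)).2 = true) := by
  simp only [evalRule, evalRegex_fst, evalRegex_snd, memB_iff, List.any_eq_true]
  constructor
  · rintro ⟨w, hw, h1⟩
    exact ⟨w, hw, fun c hc => h (h1 c hc)⟩
  · rintro ⟨w, hw, h1, c, hc, p', hp', h2⟩
    exact ⟨w, hw, fun c hc => h (h1 c hc), c, hc, p', hp', h h2⟩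

theorem derivable_mono {e : S → Name} {d : DTD S} {G G' : List Fact} (h : G ⊆ G') {f : Fact}
    (hf : derivable (d.ruleAtoms e) G f = true) : derivable (d.ruleAtoms e) G' f = true := by
  obtain ⟨a, s, pa⟩ := f
  cases pa with
  | nil =>
    simp only [derivable, Bool.and_eq_true] at hf ⊢
    refine ⟨hf.1, ?_⟩
    obtain ⟨x, hx, h1, h2⟩ := (any_ruleAtoms e d G s [] a (fun y => y.1) rfl).1 hf.2
    exact (any_ruleAtoms e d G' s [] a (fun y => y.1) rfl).2
      ⟨x, hx, h1, (evalRule_mono h e s [] x.2).1 h2⟩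
  | cons a' pa =>
    simp only [derivable, Bool.and_eq_true] at hf ⊢
    refine ⟨hf.1, ?_⟩
    have hf := hf.2
    split_ifs at hf ⊢ with hk
    · simp only [Bool.and_eq_true, memB_iff] at hf ⊢
      exact ⟨hf.1, h hf.2⟩
    · obtain ⟨x, hx, h1, h2⟩ := (any_ruleAtoms e d G s _ a (fun y => y.2) rfl).1 hf
      exact (any_ruleAtoms e d G' s _ a (fun y => y.2) rfl).2
        ⟨x, hx, h1, (evalRule_mono h e s _ x.2).2 h2⟩

/-- By monotonicity the iterates form an increasing chain of sublists of `U`. Each round either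
changes nothing or adds an element, so `U.length` rounds reach a fixed point. -/
theorem foldl_filter_fixed {α : Type} (U : List α) (P : List α → α → Bool)
    (hP : ∀ G G' f, G ⊆ G' → P G f = true → P G' f = true) :
    U.filter (P (U.foldl (fun G _ => U.filter (P G)) [])) =
      U.foldl (fun G _ => U.filter (P G)) [] := by
  have h : ∀ l : List α,
      (l.foldl (fun G _ => U.filter (P G)) []).Sublist
        (U.filter (P (l.foldl (fun G _ => U.filter (P G)) []))) ∧
      (U.filter (P (l.foldl (fun G _ => U.filter (P G)) [])) =
        l.foldl (fun G _ => U.filter (P G)) [] ∨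
      l.length ≤ (l.foldl (fun G _ => U.filter (P G)) []).length) := by
    intro l
    induction l using List.reverseRecOn with
    | nil => exact ⟨List.nil_sublist _, .inr le_rfl⟩
    | append_singleton l a ih =>
      rw [List.foldl_append]
      simp only [List.foldl_cons, List.foldl_nil, List.length_append, List.length_singleton]
      set G := l.foldl (fun G _ => U.filter (P G)) [] with hG
      obtain ⟨h1, h2⟩ := ih
      refine ⟨List.monotone_filter_right _ fun f hf => hP _ _ f h1.subset hf, ?_⟩
      by_cases heq : U.filter (P G) = G
      · left
        rw [heq, heq]
      · right
        have h3 := h1.length_le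
        rcases h2 with h2 | h2
        · exact absurd h2 heq
        · have h4 : G.length ≠ (U.filter (P G)).length :=
            fun h => heq (h1.eq_of_length h).symm
          omega
  obtain ⟨h1, h2 | h2⟩ := h U
  · exact h2
  · refine (h1.eq_of_length_le ?_).symm
    exact (List.length_filter_le _ _).trans h2

/-- By induction on the tree, the facts about its children lie in the fixed point, which then
contains the fact about the root. An inner induction on `p'` is needed because a self step stays at
the same vertex. -/
theorem facts_complete {e : S → Name} (d : DTD S) (bs : List (List Sym)) (p : List Step)
    (t : XTree S) (ht : d.Valid t) (s : State) (hs : s ∈ states bs) (hav : Avoids e s t)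
    (p' : List Step) (hp' : p' <:+ p) (hm : StepsMatch e p' t) :
    (e t.label, s, p'.map Step.atom) ∈
      facts (d.ruleAtoms e) (candidates (d.ruleAtoms e) bs (p.map Step.atom)) := by
  set U := candidates (d.ruleAtoms e) bs (p.map Step.atom) with hU
  set G := facts (d.ruleAtoms e) U with hG
  have hfix : U.filter (derivable (d.ruleAtoms e) G) = G :=
    foldl_filter_fixed U (derivable (d.ruleAtoms e)) fun _ _ _ h hf => derivable_mono h hf
  induction t using XTree.induction generalizing s p' with
  | h a ts ih =>
    obtain ⟨⟨r, hr, hrm⟩, hch⟩ := (d.valid_iff _).1 ht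
    obtain ⟨hs0, hav'⟩ := (avoids_iff _ _ _).1 hav
    simp only [XTree.label, XTree.children] at hr hrm hch hav' ⊢
    have hchild : ∀ c ∈ ts, ∀ q, q <:+ p → StepsMatch e q c →
        (e c.label, s.next (some (e c.label)), q.map Step.atom) ∈ G := fun c hc q hq hqm =>
      ih c hc (hch c hc) _ (next_mem_states hs _) (hav' c hc) q hq hqm
    have hall : ∀ b ∈ ts.map XTree.label, memB (e b, s.next (some (e b)), []) G = true := by
      intro b hb
      obtain ⟨c, hc, rfl⟩ := List.mem_map.1 hb
      exact memB_iff.2 (hchild c hc [] List.nil_suffix trivial)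
    have hcand : ∀ q : List Step, q <:+ p → (e a, s, q.map Step.atom) ∈ U := by
      intro q hq
      simp only [hU, candidates, List.mem_flatMap, List.mem_map, List.mem_tails]
      refine ⟨(.endLabel, e a) :: regexAtoms e r, ?_, s, hs, q.map Step.atom, hq.map _, rfl⟩
      exact List.mem_append_left _ (List.mem_map.2 ⟨(a, r), hr, rfl⟩)
    have hsome : ∀ (x : Step) (q : List Step), x.1 ≠ .self → x :: q <:+ p →
        (∃ c ∈ ts, ∃ q', q' ∈ stepsBelow (x.atom :: q.map Step.atom) (e c.label) ∧
          (e c.label, s.next (some (e c.label)), q') ∈ G) →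
        (e a, s, (x :: q).map Step.atom) ∈ G := by
      rintro x q hx hq ⟨c, hc, q', hq', hqG⟩
      rw [← hfix]
      refine List.mem_filter.2 ⟨hcand _ hq, ?_⟩
      have hx' : x.atom.1 ≠ .self := by
        obtain ⟨x, b⟩ := x
        cases x <;> simp [Step.atom, encAxis] at hx ⊢
      simp only [derivable, List.map_cons, if_neg hx', Bool.and_eq_true, Bool.not_eq_true',
        List.isEmpty_eq_false_iff]
      refine ⟨hs0, (any_ruleAtoms e d G s _ _ (fun y => y.2) rfl).2 ⟨(a, r), hr, rfl, ?_⟩⟩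
      refine (evalRegex_snd e _ _ r).2 ⟨_, hrm, hall, c.label, List.mem_map_of_mem hc, ?_⟩
      exact List.any_eq_true.2 ⟨q', hq', memB_iff.2 hqG⟩
    induction p' with
    | nil =>
      rw [← hfix]
      refine List.mem_filter.2 ⟨hcand _ hp', ?_⟩
      simp only [derivable, List.map_nil, Bool.and_eq_true, Bool.not_eq_true',
        List.isEmpty_eq_false_iff]
      refine ⟨hs0, (any_ruleAtoms e d G s [] _ (fun y => y.1) rfl).2 ⟨(a, r), hr, rfl, ?_⟩⟩
      exact (evalRegex_fst e _ _ r).2 ⟨_, hrm, hall⟩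
    | cons x q ihq =>
      obtain ⟨x, b⟩ := x
      have hq : q <:+ p := (List.suffix_cons _ _).trans hp'
      cases x with
      | self =>
        obtain ⟨h1, h2⟩ := hm
        have h3 := ihq hq h2
        rw [← hfix]
        refine List.mem_filter.2 ⟨hcand _ hp', ?_⟩
        simp only [derivable, List.map_cons, Bool.and_eq_true, Bool.not_eq_true',
          List.isEmpty_eq_false_iff]
        refine ⟨hs0, ?_⟩
        rw [if_pos (show (Step.atom (Axis.self, b)).1 = Token.self from rfl), Bool.and_eq_true]
        exact ⟨decide_eq_true h1.symm, memB_iff.2 h3⟩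
      | child =>
        obtain ⟨c, hc, h1, h2⟩ := hm
        refine hsome _ q (by simp) hp' ⟨c, hc, q.map Step.atom, ?_, hchild c hc q hq h2⟩
        simp [stepsBelow, Step.atom, h1]
      | descendant =>
        obtain ⟨c, hc, h1, h2⟩ := hm
        -- Either the target is a child and the step is used up, or it lies below the child `y` and
        -- the same descendant step is still to be matched there.
        obtain ⟨y, hy, rfl | h3⟩ := (XTree.strictSub_iff _ _).1 hc
        · refine hsome _ q (by simp) hp' ⟨c, hy, q.map Step.atom, ?_, hchild c hy q hq h2⟩
          simp [stepsBelow, Step.atom, h1]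
        · refine hsome _ q (by simp) hp' ⟨y, hy, ((.descendant, b) :: q).map Step.atom, ?_,
            hchild y hy ((.descendant, b) :: q) hp' ⟨c, h3, h1, h2⟩⟩
          simp [stepsBelow, Step.atom, encAxis]

/-- The fact looked up asserts the existence of a counterexample. Every tree in question has the
start symbol at its root, so the blocks of `q` can be computed beforehand. -/
theorem decideContained_iff {e : S → Name} (he : Function.Injective e) (d : DTD S)
    (p q : LPath S) :
    decideContained (e d.start) (d.ruleAtoms e) ((p.steps e).map Step.atom)
      ((q.steps e).map Step.atom) = true ↔ Contained d p q := by
  have hiff : ∀ t : XTree S, d.Matches t ↔ t.label = d.start ∧ d.Valid t := fun t => Iff.rfl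
  simp only [decideContained, Bool.not_eq_true', Contained, hiff, LPath.holds_iff he]
  rw [← Bool.not_eq_true, memB_iff]
  set bs := blocks (e d.start) ((q.steps e).map Step.atom) with hbs
  have hstate : State.next (bs, []) none ∈ states bs :=
    next_mem_states (mem_states.2 ⟨List.suffix_rfl, List.nil_prefix⟩) _
  constructor
  · rintro h t ⟨ht, hv⟩ hp
    by_contra hq
    rw [← avoids_blocks_iff, ht] at hq
    apply h
    rw [← ht]
    exact facts_complete d bs (p.steps e) t hv _ hstate hq _ List.suffix_rfl hp
  · intro h hmem
    obtain ⟨t, h1, h2, h3, h4⟩ := facts_sound he d _ _ hmem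
    simp only at h1 h3 h4
    rw [hbs, ← h1, avoids_blocks_iff] at h3
    exact h3 (h t ⟨he h1, h2⟩ (h4 _ rfl))

/-! ### Parsing -/

theorem lex_encLabel (e : S → Name) (a : S) (ts : List Token) :
    lex (encLabel e a ++ ts) = (.endLabel, e a) :: lex ts := by
  have h : ∀ w : Name, lex (w.map Token.bit ++ Token.endLabel :: ts) = (.endLabel, w) :: lex ts := by
    intro w
    induction w with
    | nil => rfl
    | cons b w ih =>
      simp only [lex, List.map_cons, List.cons_append, List.foldr_cons] at ih ⊢
      rw [ih]
      rfl
  rw [encLabel, List.append_assoc]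
  exact h (e a)

theorem lex_encRegex (e : S → Name) (r : RegularExpression S) (ts : List Token) :
    lex (encRegex e r ++ ts) = regexAtoms e r ++ lex ts := by
  induction r generalizing ts with
  | zero => rfl
  | epsilon => rfl
  | char a => exact lex_encLabel e a ts
  | plus r s hr hs =>
    rw [encRegex, regexAtoms, List.cons_append, List.append_assoc, List.cons_append,
      List.append_assoc, ← hs, ← hr]
    rfl
  | comp r s hr hs =>
    rw [encRegex, regexAtoms, List.cons_append, List.append_assoc, List.cons_append,
      List.append_assoc, ← hs, ← hr]
    rfl
  | star r hr =>
    rw [encRegex, regexAtoms, List.cons_append, List.cons_append, ← hr]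
    rfl

/-- Slashes leave no atom: composition is associative, so the order of the steps is all that
matters. -/
theorem lex_encPath (e : S → Name) (p : LPath S) (ts : List Token) :
    lex (encPath e p ++ ts) = (p.steps e).map Step.atom ++ lex ts := by
  induction p generalizing ts with
  | step x a =>
    have h : lex (encPath e (.step x a) ++ ts) =
        lexStep (encAxis x) (lex (encLabel e a ++ ts)) := rfl
    rw [h, lex_encLabel]
    cases x <;> rfl
  | seq p q hp hq =>
    rw [LPath.steps, List.map_append, List.append_assoc, ← hq, ← hp, encPath, List.cons_append,
      List.append_assoc]
    rfl

/-- The atoms of a DTD, without the start symbol. -/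
def DTD.atoms (e : S → Name) (d : DTD S) : List Atom :=
  d.rules.flatMap fun x => (.endLabel, e x.1) :: (regexAtoms e x.2 ++ [(.semicolon, [])])

theorem lex_encDTD (e : S → Name) (d : DTD S) (ts : List Token) :
    lex (encDTD e d ++ ts) = (.endLabel, e d.start) :: (d.atoms e ++ lex ts) := by
  rw [encDTD, List.append_assoc, lex_encLabel, DTD.atoms]
  congr 1
  induction d.rules with
  | nil => rfl
  | cons x l ih =>
    simp only [List.append_assoc] at ih
    simp only [List.flatMap_cons, List.append_assoc, lex_encLabel, lex_encRegex, List.cons_append,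
      List.nil_append]
    rw [← ih]
    rfl

theorem splitAtToken_ne_nil (k : Token) (l : List Atom) : splitAtToken k l ≠ [] := by
  cases l with
  | nil => simp [splitAtToken]
  | cons a l =>
    simp only [splitAtToken, List.foldr_cons]
    split_ifs <;> simp

theorem splitAtToken_append {k : Token} {l : List Atom} (hl : ∀ a ∈ l, a.1 ≠ k) (r : List Atom) :
    splitAtToken k (l ++ r) = (l ++ (splitAtToken k r).headD []) :: (splitAtToken k r).tail := by
  induction l with
  | nil =>
    obtain ⟨x, y, h⟩ := List.exists_cons_of_ne_nil (splitAtToken_ne_nil k r)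
    simp [h]
  | cons a l ih =>
    have h1 : splitAtToken k (a :: (l ++ r)) =
        (a :: (splitAtToken k (l ++ r)).headD []) :: (splitAtToken k (l ++ r)).tail := by
      simp only [splitAtToken, List.foldr_cons]
      rw [if_neg (hl a (by simp))]
    rw [List.cons_append, h1, ih fun b hb => hl b (by simp [hb])]
    simp

theorem splitAtToken_append_cons {k : Token} {l : List Atom} (hl : ∀ a ∈ l, a.1 ≠ k)
    (r : List Atom) (w : Name) :
    splitAtToken k (l ++ (k, w) :: r) = l :: splitAtToken k r := by
  have h : splitAtToken k ((k, w) :: r) = [] :: splitAtToken k r := by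
    simp [splitAtToken]
  rw [splitAtToken_append hl, h]
  simp

theorem splitAtToken_of_forall {k : Token} {l : List Atom} (hl : ∀ a ∈ l, a.1 ≠ k) :
    splitAtToken k l = [l] := by
  have := splitAtToken_append hl []
  simpa [splitAtToken] using this

theorem regexAtoms_ne {e : S → Name} {r : RegularExpression S} {a : Atom}
    (ha : a ∈ regexAtoms e r) : a.1 ≠ .separator ∧ a.1 ≠ .semicolon := by
  induction r with
  | zero => simp [regexAtoms] at ha; simp [ha]
  | epsilon => simp [regexAtoms] at ha; simp [ha]
  | char b => simp [regexAtoms] at ha; simp [ha]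
  | plus r s hr hs =>
    simp only [regexAtoms, List.mem_cons, List.mem_append] at ha
    rcases ha with rfl | ha | ha
    · simp
    · exact hr ha
    · exact hs ha
  | comp r s hr hs =>
    simp only [regexAtoms, List.mem_cons, List.mem_append] at ha
    rcases ha with rfl | ha | ha
    · simp
    · exact hr ha
    · exact hs ha
  | star r hr =>
    simp only [regexAtoms, List.mem_cons] at ha
    rcases ha with rfl | ha
    · simp
    · exact hr ha

theorem DTD.atoms_ne {e : S → Name} {d : DTD S} {a : Atom} (ha : a ∈ d.atoms e) :
    a.1 ≠ .separator := by
  simp only [DTD.atoms, List.mem_flatMap, List.mem_cons, List.mem_append] at ha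
  obtain ⟨x, _, rfl | ha | rfl | ha⟩ := ha
  · simp
  · exact (regexAtoms_ne ha).1
  · simp
  · simp at ha

theorem Step.atom_ne (a : Step) : a.atom.1 ≠ .separator := by
  obtain ⟨x, w⟩ := a
  cases x <;> simp [Step.atom, encAxis]

theorem splitAtToken_atoms (e : S → Name) (d : DTD S) :
    splitAtToken .semicolon (d.atoms e) = d.ruleAtoms e := by
  rw [DTD.atoms, DTD.ruleAtoms]
  induction d.rules with
  | nil => rfl
  | cons x l ih =>
    have h := splitAtToken_append_cons (k := .semicolon)
      (l := (.endLabel, e x.1) :: regexAtoms e x.2) (by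
        intro a ha
        rcases List.mem_cons.1 ha with rfl | ha
        · simp
        · exact (regexAtoms_ne ha).2)
      (l.flatMap fun x => (.endLabel, e x.1) :: (regexAtoms e x.2 ++ [(.semicolon, [])])) []
    rw [ih] at h
    simpa [List.flatMap_cons] using h

theorem decideTokens_encInput (e : S → Name) (x : Input S) :
    decideTokens (encInput e x) = decideContained (e x.d.start) (x.d.ruleAtoms e)
      ((x.p.steps e).map Step.atom) ((x.q.steps e).map Step.atom) := by
  have hsep : ∀ ts, lex (Token.separator :: ts) = (Token.separator, []) :: lex ts := fun _ => rfl
  have hstep : ∀ p : LPath S, ∀ a ∈ (p.steps e).map Step.atom, a.1 ≠ .separator := by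
    intro p a ha
    obtain ⟨b, _, rfl⟩ := List.mem_map.1 ha
    exact b.atom_ne
  have hlex : lex (encInput e x) = ((.endLabel, e x.d.start) :: x.d.atoms e) ++
      (.separator, []) :: ((x.p.steps e).map Step.atom ++
      (.separator, []) :: (x.q.steps e).map Step.atom) := by
    have hq := lex_encPath e x.q []
    rw [List.append_nil] at hq
    simp only [encInput, List.append_assoc, lex_encDTD, List.cons_append,
      lex_encPath, hsep, List.nil_append]
    rw [hq]
    simp [lex]
  have hsplit : splitAtToken .separator (lex (encInput e x)) =
      [(.endLabel, e x.d.start) :: x.d.atoms e, (x.p.steps e).map Step.atom,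
        (x.q.steps e).map Step.atom] := by
    rw [hlex, splitAtToken_append_cons, splitAtToken_append_cons (hstep _),
      splitAtToken_of_forall (hstep _)]
    intro a ha
    rcases List.mem_cons.1 ha with rfl | ha
    · simp
    · exact DTD.atoms_ne ha
  simp only [decideTokens, hsplit, List.headD_cons, List.tail_cons, splitAtToken_atoms]

end XPathDTD

theorem theorem4p1 {S : Type} (e : S → List Bool) (he : Function.Injective e) :
    XPathDTD.DecidableInPolyTime (XPathDTD.encInput e)
      (fun x : XPathDTD.Input S => XPathDTD.Contained x.d x.p x.q) := by
  refine StackProgram.PT.decidableInPolyTime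
    -- This undoes the reversal caused by reading the input onto a stack.
    (f := fun ts => XPathDTD.decideTokens ts.reverse)
    (XPathDTD.pt_decideTokens.comp (.reverse .id)) _ _ fun x => ?_
  rw [List.reverse_reverse, XPathDTD.decideTokens_encInput, XPathDTD.decideContained_iff he]
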